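/- Let $k$ be an algebraically closed field of characteristic $0$, and let $C_1, C_2 \subset \mathbb{P}^2$ be two distinct nonsingular irreducible plane curves of degree $2$ over $k$, with function fields $k(C_1)$ and $k(C_2)$. For a point $P \in \mathbb{P}^2$ let $\pi_P : C_i \dashrightarrow \mathbb{P}^1$ be the projection with centre $P$, where $\mathbb{P}^1$ is the line of all lines through $P$, and let $\pi_P^* : k(\mathbb{P}^1) \hookrightarrow k(C_i)$ be the induced embedding of function fields. Call $P$ an outer simultaneous Galois point for $C_1 \cup C_2$ if $P \notin C_1 \cup C_2$, both field extensions $k(C_i)/\pi_P^* k(\mathbb{P}^1)$ ($i = 1, 2$) are Galois, and $k(C_1) \simeq k(C_2)$ as $k(\mathbb{P}^1)$-algebras. Then the set of outer simultaneous Galois points for $C_1 \cup C_2$ is finite, and the number of its elements is $0$, $1$, $3$ or $6$. -/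

import Mathlib

open MvPolynomial
open scoped LinearAlgebra.Projectivization

noncomputable section

namespace SGPoints

section DegreeZero

variable {k A B : Type*} [Field k] [CommRing A] [IsDomain A] [Algebra k A]
  [CommRing B] [IsDomain B] [Algebra k B]

/-- For a domain `A` over `k` with homogeneous parts `𝒜 n`, the field of all fractions `a / b`
with `a` and `b` homogeneous of the same degree and `b ≠ 0`, as a subfield of `Frac A`. If `A` is
the homogeneous coordinate ring of a projective variety, this is its function field. -/
def degreeZeroField (𝒜 : ℕ → Submodule k A) [SetLike.GradedMonoid 𝒜] :
    IntermediateField k (FractionRing A) where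
  carrier := {x | ∃ n, ∃ a ∈ 𝒜 n, ∃ b ∈ 𝒜 n, b ≠ 0 ∧
    x = algebraMap A (FractionRing A) a / algebraMap A (FractionRing A) b}
  mul_mem' := by
    rintro x y ⟨n, a, ha, b, hb, hb0, rfl⟩ ⟨m, c, hc, d, hd, hd0, rfl⟩
    exact ⟨n + m, a * c, SetLike.mul_mem_graded ha hc, b * d, SetLike.mul_mem_graded hb hd,
      mul_ne_zero hb0 hd0, by rw [map_mul, map_mul, div_mul_div_comm]⟩
  add_mem' := by
    rintro x y ⟨n, a, ha, b, hb, hb0, rfl⟩ ⟨m, c, hc, d, hd, hd0, rfl⟩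
    have hb' : algebraMap A (FractionRing A) b ≠ 0 := by simpa using hb0
    have hd' : algebraMap A (FractionRing A) d ≠ 0 := by simpa using hd0
    refine ⟨n + m, a * d + b * c, add_mem (SetLike.mul_mem_graded ha hd)
      (SetLike.mul_mem_graded hb hc), b * d, SetLike.mul_mem_graded hb hd,
      mul_ne_zero hb0 hd0, ?_⟩
    rw [map_add, map_mul, map_mul, map_mul, div_add_div _ _ hb' hd']
  algebraMap_mem' := by
    intro r
    refine ⟨0, algebraMap k A r, ?_, 1, SetLike.one_mem_graded 𝒜, one_ne_zero, ?_⟩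
    · rw [Algebra.algebraMap_eq_smul_one]
      exact (𝒜 0).smul_mem r (SetLike.one_mem_graded 𝒜)
    · rw [map_one, div_one, ← IsScalarTower.algebraMap_apply]
  inv_mem' := by
    rintro x ⟨n, a, ha, b, hb, hb0, rfl⟩
    by_cases ha0 : a = 0
    · exact ⟨0, 0, zero_mem _, 1, SetLike.one_mem_graded 𝒜, one_ne_zero, by simp [ha0]⟩
    · exact ⟨n, b, hb, a, ha, ha0, by rw [inv_div]⟩

/-- The homomorphism `Frac A → Frac B` induced by an injective homomorphism `A → B`. -/
def fracMap (f : A →ₐ[k] B) (hf : Function.Injective f) :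
    FractionRing A →ₐ[k] FractionRing B :=
  IsFractionRing.liftAlgHom (K := FractionRing A) (L := FractionRing B)
    (g := (IsScalarTower.toAlgHom k B (FractionRing B)).comp f)
    ((IsFractionRing.injective B (FractionRing B)).comp hf)

theorem fracMap_algebraMap (f : A →ₐ[k] B) (hf : Function.Injective f) (a : A) :
    fracMap f hf (algebraMap A (FractionRing A) a) = algebraMap B (FractionRing B) (f a) := by
  exact IsFractionRing.lift_algebraMap (K := FractionRing A) (L := FractionRing B)
    (g := ((IsScalarTower.toAlgHom k B (FractionRing B)).comp f).toRingHom)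
    ((IsFractionRing.injective B (FractionRing B)).comp hf) a

/-- The homomorphism `a / b ↦ f a / f b` of degree-zero fields induced by an injective
homomorphism `f` that preserves degrees. -/
def degreeZeroMap (𝒜 : ℕ → Submodule k A) [SetLike.GradedMonoid 𝒜]
    (ℬ : ℕ → Submodule k B) [SetLike.GradedMonoid ℬ]
    (f : A →ₐ[k] B) (hf : Function.Injective f) (hdeg : ∀ n, ∀ a ∈ 𝒜 n, f a ∈ ℬ n) :
    degreeZeroField 𝒜 →ₐ[k] degreeZeroField ℬ :=
  ((fracMap f hf).comp (degreeZeroField 𝒜).val).codRestrict (degreeZeroField ℬ).toSubalgebra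
    (by
      rintro ⟨x, n, a, ha, b, hb, hb0, rfl⟩
      refine ⟨n, f a, hdeg n a ha, f b, hdeg n b hb, ?_, ?_⟩
      · rwa [Ne, map_eq_zero_iff f hf]
      · simp [fracMap_algebraMap])

end DegreeZero

variable {k : Type*} [Field k]

/-- An irreducible curve in the projective plane, given by an irreducible form. -/
structure IrreduciblePlaneCurve (k : Type*) [Field k] where
  form : MvPolynomial (Fin 3) k
  isHomogeneous : form.IsHomogeneous form.totalDegree
  irreducible : Irreducible form

namespace IrreduciblePlaneCurve

variable (C : IrreduciblePlaneCurve k)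

def degree : ℕ := C.form.totalDegree

/-- The set of points of the curve. -/
def points : Set (ℙ k (Fin 3 → k)) := {P | eval P.rep C.form = 0}

/-- The partial derivatives of the form have no common zero on the curve. -/
def Nonsingular : Prop :=
  ∀ P ∈ C.points, ∃ i, eval P.rep (pderiv i C.form) ≠ 0

/-- The homogeneous coordinate ring `k[X, Y, Z] / (F)`. -/
abbrev CoordRing : Type _ := MvPolynomial (Fin 3) k ⧸ Ideal.span {C.form}

instance : (Ideal.span {C.form}).IsPrime :=
  (Ideal.span_singleton_prime C.irreducible.ne_zero).2 C.irreducible.prime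

/-- The part of degree `n` of the homogeneous coordinate ring. -/
def coordPart (n : ℕ) : Submodule k C.CoordRing :=
  (homogeneousSubmodule (Fin 3) k n).map
    (Ideal.Quotient.mkₐ k (Ideal.span {C.form})).toLinearMap

instance : SetLike.GradedMonoid C.coordPart where
  one_mem := ⟨1, isHomogeneous_one _ _, map_one (Ideal.Quotient.mkₐ k _)⟩
  mul_mem := by
    rintro i j _ _ ⟨a, ha, rfl⟩ ⟨b, hb, rfl⟩
    exact ⟨a * b, IsHomogeneous.mul ha hb, map_mul (Ideal.Quotient.mkₐ k _) a b⟩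

/-- The function field `k(C)`. -/
abbrev functionField : IntermediateField k (FractionRing C.CoordRing) :=
  degreeZeroField C.coordPart

end IrreduciblePlaneCurve

/-- The linear forms that vanish at the point `P`. -/
def linearFormsAt (P : ℙ k (Fin 3 → k)) : Set (MvPolynomial (Fin 3) k) :=
  {L | L.IsHomogeneous 1 ∧ eval P.rep L = 0}

/-- The homogeneous coordinate ring of the projective line of all lines through `P`: a linear form
on `k³ / P` is a linear form on `k³` vanishing at `P`, so this is the polynomial ring in two such
forms that are linearly independent. -/
abbrev pencilRing (P : ℙ k (Fin 3 → k)) : Subalgebra k (MvPolynomial (Fin 3) k) :=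
  Algebra.adjoin k (linearFormsAt P)

/-- The part of degree `n` of the ring `pencilRing P`. -/
def pencilPart (P : ℙ k (Fin 3 → k)) (n : ℕ) : Submodule k (pencilRing P) :=
  (homogeneousSubmodule (Fin 3) k n).comap (pencilRing P).val.toLinearMap

instance (P : ℙ k (Fin 3 → k)) : SetLike.GradedMonoid (pencilPart P) where
  one_mem := isHomogeneous_one _ _
  mul_mem := by
    intro i j a b ha hb
    exact IsHomogeneous.mul (show IsHomogeneous (a : MvPolynomial (Fin 3) k) i from ha)
      (show IsHomogeneous (b : MvPolynomial (Fin 3) k) j from hb)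

/-- The function field `k(ℙ¹)` of the target `ℙ¹` of the projection with centre `P`, that is, of
the projective line of all lines through `P`. -/
abbrev pencilField (P : ℙ k (Fin 3 → k)) : IntermediateField k (FractionRing (pencilRing P)) :=
  degreeZeroField (pencilPart P)

/-- The homomorphism of homogeneous coordinate rings that defines the projection
`π_P : C ⇢ ℙ¹` with centre `P`: restriction to `C` of the forms in `pencilRing P`. -/
def projectionHom (P : ℙ k (Fin 3 → k)) (C : IrreduciblePlaneCurve k) :
    pencilRing P →ₐ[k] C.CoordRing :=
  (Ideal.Quotient.mkₐ k (Ideal.span {C.form})).comp (pencilRing P).val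

/-- The projection `π_P : C ⇢ ℙ¹` is dominant, so that it induces an embedding of function
fields. Over an algebraically closed field this fails only if `C` is a line through `P`. -/
def ProjectionDominant (P : ℙ k (Fin 3 → k)) (C : IrreduciblePlaneCurve k) : Prop :=
  Function.Injective (projectionHom P C)

/-- The embedding `π_P^* : k(ℙ¹) → k(C)`, which sends `G / H` to its restriction to `C`. -/
def projectionPullback (P : ℙ k (Fin 3 → k)) (C : IrreduciblePlaneCurve k)
    (h : ProjectionDominant P C) : pencilField P →ₐ[k] C.functionField :=
  degreeZeroMap (pencilPart P) C.coordPart (projectionHom P C) h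
    (fun _ a ha => ⟨(a : MvPolynomial (Fin 3) k), ha, rfl⟩)

/-- `P` is a simultaneous Galois point for the curves `C i`: every extension
`k(C i) / π_P^* k(ℙ¹)` is Galois, and the fields `k(C i)` are pairwise isomorphic as
`k(ℙ¹)`-algebras. -/
def IsSGPoint {ι : Type*} (C : ι → IrreduciblePlaneCurve k) (P : ℙ k (Fin 3 → k)) : Prop :=
  ∃ h : ∀ i, ProjectionDominant P (C i),
    (∀ i, IsGalois (projectionPullback P (C i) (h i)).fieldRange (C i).functionField) ∧
    ∀ i j, ∃ φ : (C i).functionField ≃+* (C j).functionField,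
      ∀ f : pencilField P,
        φ (projectionPullback P (C i) (h i) f) = projectionPullback P (C j) (h j) f

/-- The set of outer simultaneous Galois points: those that lie on none of the curves. -/
def outerSGPoints {ι : Type*} (C : ι → IrreduciblePlaneCurve k) : Set (ℙ k (Fin 3 → k)) :=
  {P | IsSGPoint C P ∧ ∀ i, P ∉ (C i).points}

end SGPoints

end

/-! Let a conic be F(x) = M(x, x) with M symmetric and invertible, and let P = [p] lie off it, so
that q = M(p, p) is nonzero. Put ℓ = M(p, ·). The form D = ℓ² - qF depends only on the line through
P and x. On the conic ℓ² = D, so for a linear form m through P the field k(C) is k(ℙ¹)(ℓ/m) with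
(ℓ/m)² = D/m². Irreducibility of F makes D squarefree, so the extension is quadratic, hence Galois
in characteristic 0. By Kummer theory and unique factorization, two such fields are isomorphic over
k(ℙ¹) exactly when the discriminants D are proportional (`isSGPoint_iff`).

Now dualize. Since D(x) = -(adj M)(p × x, p × x), the discriminant is, up to sign, the dual conic
restricted to the line p^⊥ of the dual plane (`eval_discriminant_quadForm`). As P is off the conic,
this binary form has two distinct zeros, the two tangents through P. Proportional discriminants mean
that the tangents through P are the same for both conics. Conversely, any two common tangents meet
in a point off both conics, and a binary quadratic form with two prescribed distinct zeros is unique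
up to a scalar. Thus outer simultaneous Galois points correspond to pairs of common points of the
dual conics (`encard_outerSGPoints_eq_choose`).

Distinct nonsingular conics have distinct duals, which share n ≤ 4 points
(`encard_commonZeros_le_four`). The count is the binomial coefficient of n over 2: 0, 0, 1, 3 or 6.
-/

noncomputable section

namespace SGPoints

/-! ### Quadratic extensions generated by a square root -/

section QuadraticExtension

open IntermediateField

variable {K L : Type*} [Field K] [Field L] [Algebra K L]

theorem algebraAdjoin_eq_top_of_sq_eq {d : K} {u : L} (hu : u ^ 2 = algebraMap K L d)
    (htop : K⟮u⟯ = ⊤) : Algebra.adjoin K {u} = ⊤ := by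
  have hint : IsIntegral K u := by
    refine ⟨Polynomial.X ^ 2 - Polynomial.C d, Polynomial.monic_X_pow_sub_C d two_ne_zero, ?_⟩
    simp [hu]
  rw [← adjoin_simple_toSubalgebra_of_isAlgebraic hint.isAlgebraic, htop, top_toSubalgebra]

theorem exists_eq_add_mul_of_sq_eq {d : K} {u : L} (hu : u ^ 2 = algebraMap K L d)
    (htop : K⟮u⟯ = ⊤) (x : L) : ∃ a b : K, x = algebraMap K L a + algebraMap K L b * u := by
  have hx : x ∈ Algebra.adjoin K {u} := by simp [algebraAdjoin_eq_top_of_sq_eq hu htop]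
  induction hx using Algebra.adjoin_induction with
  | mem x hx => exact ⟨0, 1, by simpa using hx⟩
  | algebraMap r => exact ⟨r, 0, by simp⟩
  | add x y _ _ hx hy =>
    obtain ⟨a, b, rfl⟩ := hx
    obtain ⟨c, e, rfl⟩ := hy
    exact ⟨a + c, b + e, by simp only [map_add]; ring⟩
  | mul x y _ _ hx hy =>
    obtain ⟨a, b, rfl⟩ := hx
    obtain ⟨c, e, rfl⟩ := hy
    refine ⟨a * c + b * e * d, a * e + b * c, ?_⟩
    simp only [map_add, map_mul, ← hu]
    ring

theorem isSplittingField_X_sq_sub_C {d : K} {u : L} (hu : u ^ 2 = algebraMap K L d)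
    (htop : K⟮u⟯ = ⊤) : Polynomial.IsSplittingField K L (Polynomial.X ^ 2 - Polynomial.C d) := by
  have hfac : (Polynomial.X ^ 2 - Polynomial.C d).map (algebraMap K L) =
      (Polynomial.X - Polynomial.C u) * (Polynomial.X - Polynomial.C (-u)) := by
    simp only [Polynomial.map_sub, Polynomial.map_pow, Polynomial.map_X, Polynomial.map_C, ← hu,
      map_neg, map_pow]
    ring
  refine ⟨?_, ?_⟩
  · rw [hfac]
    exact (Polynomial.Splits.X_sub_C _).mul (Polynomial.Splits.X_sub_C _)
  · rw [eq_top_iff, ← algebraAdjoin_eq_top_of_sq_eq hu htop]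
    refine Algebra.adjoin_mono ?_
    rw [Set.singleton_subset_iff, Polynomial.mem_rootSet]
    exact ⟨Polynomial.X_pow_sub_C_ne_zero two_pos d, by simp [hu]⟩

theorem isGalois_of_sq_eq [CharZero K] {d : K} {u : L} (hd : d ≠ 0)
    (hu : u ^ 2 = algebraMap K L d) (htop : K⟮u⟯ = ⊤) : IsGalois K L := by
  have := isSplittingField_X_sq_sub_C hu htop
  exact IsGalois.of_separable_splitting_field
    (Polynomial.separable_X_pow_sub_C d (n := 2) (by norm_num) hd)

variable {L' : Type*} [Field L'] [Algebra K L']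

/-- Both fields are splitting fields of X² - d: in `L'` the root is e u' in place of u'. -/
theorem nonempty_algEquiv_of_sq_eq {d d' e : K} {u : L} {u' : L'}
    (hu : u ^ 2 = algebraMap K L d) (htop : K⟮u⟯ = ⊤)
    (hu' : u' ^ 2 = algebraMap K L' d') (htop' : K⟮u'⟯ = ⊤) (he : e ≠ 0) (hd : d = e ^ 2 * d') :
    Nonempty (L ≃ₐ[K] L') := by
  have h1 := isSplittingField_X_sq_sub_C hu htop
  have htop2 : K⟮algebraMap K L' e * u'⟯ = ⊤ := by
    rw [eq_top_iff, ← htop', adjoin_simple_le_iff]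
    have h := mul_mem (IntermediateField.algebraMap_mem K⟮algebraMap K L' e * u'⟯ e⁻¹)
      (mem_adjoin_simple_self K (algebraMap K L' e * u'))
    rwa [← mul_assoc, ← map_mul, inv_mul_cancel₀ he, map_one, one_mul] at h
  have h2 : Polynomial.IsSplittingField K L' (Polynomial.X ^ 2 - Polynomial.C d) :=
    isSplittingField_X_sq_sub_C (by rw [mul_pow, hu', hd, map_mul, map_pow]) htop2
  exact ⟨(Polynomial.IsSplittingField.algEquiv L (Polynomial.X ^ 2 - Polynomial.C d)).trans
    (Polynomial.IsSplittingField.algEquiv L' (Polynomial.X ^ 2 - Polynomial.C d)).symm⟩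

/-- Write φ(u) = a + b u' and square: 2ab u' lies in `K`. So b = 0, or a = 0, or u' itself lies in
`K`, which gives the three alternatives. The first two are degenerate and are excluded later by
squarefreeness. -/
theorem isSquare_or_of_algEquiv [CharZero K] {d d' : K} {u : L} {u' : L'}
    (hu : u ^ 2 = algebraMap K L d)
    (hu' : u' ^ 2 = algebraMap K L' d') (htop' : K⟮u'⟯ = ⊤) (φ : L →ₐ[K] L') :
    IsSquare d ∨ IsSquare d' ∨ ∃ b, d = b ^ 2 * d' := by
  obtain ⟨a, b, hab⟩ := exists_eq_add_mul_of_sq_eq hu' htop' (φ u)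
  have hinj := FaithfulSMul.algebraMap_injective K L'
  have hsq : (φ u) ^ 2 = algebraMap K L' d := by rw [← map_pow, hu, φ.commutes]
  have h : algebraMap K L' (2 * a * b) * u' = algebraMap K L' (d - a ^ 2 - b ^ 2 * d') := by
    rw [hab] at hsq
    simp only [map_mul, map_sub, map_pow, ← hsq, ← hu', map_ofNat]
    ring
  by_cases hab0 : 2 * a * b = 0
  · rw [hab0, map_zero, zero_mul, eq_comm, map_eq_zero_iff _ hinj] at h
    rcases mul_eq_zero.1 hab0 with h0 | h0
    · have ha : a = 0 := by simpa using h0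
      exact Or.inr (Or.inr ⟨b, by rw [ha] at h; linear_combination h⟩)
    · exact Or.inl ⟨a, by rw [h0] at h; linear_combination h⟩
  · refine Or.inr (Or.inl ⟨(2 * a * b)⁻¹ * (d - a ^ 2 - b ^ 2 * d'), hinj ?_⟩)
    have hu'2 : u' = algebraMap K L' ((2 * a * b)⁻¹ * (d - a ^ 2 - b ^ 2 * d')) := by
      rw [map_mul, ← h, ← mul_assoc, ← map_mul, inv_mul_cancel₀ hab0, map_one, one_mul]
    rw [← hu', map_mul, ← hu'2, sq]

end QuadraticExtension

/-! ### Linear and quadratic forms in three variables -/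

section Forms

variable {k : Type*} [Field k]

/-- The linear form with coefficient vector `a`. -/
def linForm (a : Fin 3 → k) : MvPolynomial (Fin 3) k := ∑ i, C (a i) * X i

theorem linForm_isHomogeneous (a : Fin 3 → k) : (linForm a).IsHomogeneous 1 :=
  IsHomogeneous.sum _ _ _ fun i _ => by
    simpa using (isHomogeneous_C (Fin 3) (a i)).mul (isHomogeneous_X k i)

@[simp]
theorem eval_linForm (a x : Fin 3 → k) : eval x (linForm a) = a ⬝ᵥ x := by
  simp [linForm, dotProduct]

theorem exists_eq_linForm {L : MvPolynomial (Fin 3) k} (hL : L.IsHomogeneous 1) :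
    ∃ a, L = linForm a := by
  have h := hL.sum_X_mul_pderiv
  refine ⟨fun i => coeff 0 (pderiv i L), ?_⟩
  rw [one_smul] at h
  rw [linForm, ← h]
  refine Finset.sum_congr rfl fun i _ => ?_
  have h0 : (pderiv i L).IsHomogeneous 0 := hL.pderiv
  rw [h, mul_comm]
  congr 1
  exact totalDegree_eq_zero_iff_eq_C.1 (Nat.le_zero.1 h0.totalDegree_le)

/-- The quadratic form with matrix `M`. -/
def quadForm (M : Matrix (Fin 3) (Fin 3) k) : MvPolynomial (Fin 3) k :=
  ∑ i, X i * linForm (M i)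

@[simp]
theorem eval_quadForm (M : Matrix (Fin 3) (Fin 3) k) (x : Fin 3 → k) :
    eval x (quadForm M) = x ⬝ᵥ M.mulVec x := by
  simp [quadForm, dotProduct, Matrix.mulVec]

theorem quadForm_isHomogeneous (M : Matrix (Fin 3) (Fin 3) k) : (quadForm M).IsHomogeneous 2 :=
  IsHomogeneous.sum _ _ _ fun i _ => (isHomogeneous_X k i).mul (linForm_isHomogeneous (M i))

/-- Euler's identity, applied to F and then to its partial derivatives, writes F through half its
Hessian. -/
theorem exists_eq_quadForm [CharZero k] {F : MvPolynomial (Fin 3) k} (hF : F.IsHomogeneous 2) :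
    ∃ M : Matrix (Fin 3) (Fin 3) k, M.IsSymm ∧ F = quadForm M := by
  have hd : ∀ i, (pderiv i F).IsHomogeneous 1 := fun i => hF.pderiv
  have hdd : ∀ i j, pderiv j (pderiv i F) = C (coeff 0 (pderiv j (pderiv i F))) := fun i j =>
    totalDegree_eq_zero_iff_eq_C.1 (Nat.le_zero.1 (hd i).pderiv.totalDegree_le)
  suffices h : F = quadForm (Matrix.of fun i j => 2⁻¹ * coeff 0 (pderiv j (pderiv i F))) by
    generalize (Matrix.of fun i j => 2⁻¹ * coeff 0 (pderiv j (pderiv i F))) = N at h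
    -- Symmetrizing makes it unnecessary to know that partial derivatives commute.
    refine ⟨(2⁻¹ : k) • (N + N.transpose), ?_, ?_⟩
    · rw [Matrix.IsSymm, Matrix.transpose_smul, Matrix.transpose_add, Matrix.transpose_transpose,
        add_comm]
    · rw [h]
      refine MvPolynomial.funext fun x => ?_
      simp only [eval_quadForm, Matrix.smul_mulVec, Matrix.add_mulVec, dotProduct_smul,
        dotProduct_add, Matrix.mulVec_transpose, smul_eq_mul]
      rw [dotProduct_comm x (Matrix.vecMul x N), ← Matrix.dotProduct_mulVec]
      ring
  have h2 : (C 2⁻¹ : MvPolynomial (Fin 3) k) * 2 = 1 := by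
    rw [show (2 : MvPolynomial (Fin 3) k) = C 2 from (map_ofNat C 2).symm, ← C_mul]
    simp
  have h := hF.sum_X_mul_pderiv
  have : F = C 2⁻¹ * (2 • F) := by
    rw [nsmul_eq_mul, Nat.cast_ofNat, ← mul_assoc, h2, one_mul]
  rw [quadForm]
  refine this.trans ?_
  rw [← h, Finset.mul_sum]
  refine Finset.sum_congr rfl fun i _ => ?_
  rw [mul_left_comm]
  congr 1
  have h1 := (hd i).sum_X_mul_pderiv
  rw [one_smul] at h1
  rw [linForm]
  conv_lhs => rw [← h1]
  rw [Finset.mul_sum]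
  refine Finset.sum_congr rfl fun j _ => ?_
  rw [Matrix.of_apply, C_mul, ← hdd]
  ring

theorem aeval_div_of_isHomogeneous {B : Type*} [Field B] [Algebra k B] {σ : Type*}
    {F : MvPolynomial σ k} {n : ℕ} (hF : F.IsHomogeneous n) (x : σ → B) (m : B) :
    aeval (fun i => x i / m) F = aeval x F / m ^ n := by
  rw [aeval_def, aeval_def, eval₂_eq, eval₂_eq, Finset.sum_div]
  refine Finset.sum_congr rfl fun d hd => ?_
  have hdeg : ∑ i ∈ d.support, d i = n := by
    have := hF (mem_support_iff.1 hd)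
    rwa [Finsupp.weight_apply, Finsupp.sum, Finset.sum_congr rfl (fun i _ => by simp; rfl)] at this
  rw [mul_div_assoc]
  congr 1
  simp_rw [div_pow]
  rw [Finset.prod_div_distrib, Finset.prod_pow_eq_pow_sum, hdeg]

end Forms

/-! ### The discriminant of a conic along the lines through a point -/

section Discriminant

variable {k : Type*} [Field k]

theorem eval_add_smul_of_isHomogeneous_one {L : MvPolynomial (Fin 3) k} (hL : L.IsHomogeneous 1)
    (x p : Fin 3 → k) (t : k) : eval (x + t • p) L = eval x L + t * eval p L := by
  obtain ⟨a, rfl⟩ := exists_eq_linForm hL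
  simp [dotProduct_add, dotProduct_smul]

theorem eval_add_smul_of_mem_pencilRing {P : ℙ k (Fin 3 → k)} {G : MvPolynomial (Fin 3) k}
    (hG : G ∈ pencilRing P) (x : Fin 3 → k) (t : k) : eval (x + t • P.rep) G = eval x G := by
  induction hG using Algebra.adjoin_induction with
  | mem L hL => rw [eval_add_smul_of_isHomogeneous_one hL.1, hL.2, mul_zero, add_zero]
  | algebraMap r => simp [algebraMap_eq]
  | add G H _ _ hG hH => rw [map_add, map_add, hG, hH]
  | mul G H _ _ hG hH => rw [map_mul, map_mul, hG, hH]

theorem exists_linearForm_ne_zero (P : ℙ k (Fin 3 → k)) : ∃ m ∈ linearFormsAt P, m ≠ 0 := by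
  have hlin : ∀ a : Fin 3 → k, a ≠ 0 → linForm a ≠ 0 := by
    intro a ha h
    apply ha
    rw [← dotProduct_eq_zero_iff]
    intro x
    rw [← eval_linForm, h, map_zero]
  by_cases h1 : P.rep 1 = 0
  · refine ⟨linForm ![0, 1, 0], ⟨linForm_isHomogeneous _, ?_⟩, hlin _ fun h => ?_⟩
    · simp [h1, dotProduct, Fin.sum_univ_three]
    · simpa using congrFun h 1
  · refine ⟨linForm ![-P.rep 1, P.rep 0, 0], ⟨linForm_isHomogeneous _, ?_⟩, hlin _ fun h => ?_⟩
    · simp only [eval_linForm, dotProduct, Fin.sum_univ_three]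
      simp
      ring
    · exact h1 (by simpa using congrFun h 0)

/-- `ℓ` is a linear form with `ℓ(P) = q ≠ 0`, and `D = ℓ² - q F` is a quadratic form in the
coordinates on the pencil of lines through `P`. So `D` is the discriminant of the restrictions of
the quadratic form `F` to these lines. -/
structure IsDiscriminant (P : ℙ k (Fin 3 → k)) (F ℓ D : MvPolynomial (Fin 3) k) (q : k) :
    Prop where
  linear : ℓ.IsHomogeneous 1
  eval_linear : eval P.rep ℓ = q
  ne_zero : q ≠ 0
  mem : D ∈ pencilRing P
  quadratic : D.IsHomogeneous 2
  eq : D = ℓ ^ 2 - C q * F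

namespace IsDiscriminant

variable {P : ℙ k (Fin 3 → k)} {F ℓ D : MvPolynomial (Fin 3) k} {q : k}

theorem sq_eq (h : IsDiscriminant P F ℓ D q) : ℓ ^ 2 = D + C q * F := by
  rw [h.eq]; ring

/-- The line through any x in direction p meets F = 0: solve ℓ(x + tp) = s with s² = D(x). Since G
is constant along that line and vanishes where F does, G(x) = 0. -/
theorem eq_zero_of_dvd [IsAlgClosed k] (h : IsDiscriminant P F ℓ D q)
    {G : MvPolynomial (Fin 3) k} (hG : G ∈ pencilRing P) (hFG : F ∣ G) : G = 0 := by
  have : Infinite k := IsAlgClosed.instInfinite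
  refine MvPolynomial.funext fun x => ?_
  obtain ⟨s, hs⟩ := IsAlgClosed.exists_pow_nat_eq (eval x D) two_pos
  set t := (s - eval x ℓ) / q
  have hq := h.ne_zero
  have hF : eval (x + t • P.rep) F = 0 := by
    have h1 := congrArg (eval (x + t • P.rep)) h.sq_eq
    rw [map_pow, map_add, map_mul, eval_C, eval_add_smul_of_mem_pencilRing h.mem,
      eval_add_smul_of_isHomogeneous_one h.linear, h.eval_linear,
      show eval x ℓ + t * q = s by simp only [t]; field_simp; ring, hs, left_eq_add] at h1
    exact (mul_eq_zero.1 h1).resolve_left hq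
  obtain ⟨H, rfl⟩ := hFG
  rw [← eval_add_smul_of_mem_pencilRing hG x t, map_mul, hF, zero_mul, map_zero]

/-- If D = w², then qF = (ℓ - w)(ℓ + w) splits into factors of degree at most 1, against
irreducibility. The degree bound on w admits w = 0, which yields D ≠ 0. -/
theorem ne_sq (h : IsDiscriminant P F ℓ D q) (hF : Irreducible F)
    (hdeg : F.totalDegree = 2) {w : MvPolynomial (Fin 3) k} (hw : w.totalDegree ≤ 1) :
    D ≠ w ^ 2 := by
  intro hD
  have hmul : C q * F = (ℓ - w) * (ℓ + w) := by
    have := h.sq_eq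
    rw [hD] at this
    linear_combination -this
  have hqu : IsUnit (C q : MvPolynomial (Fin 3) k) := (isUnit_iff_ne_zero.2 h.ne_zero).map C
  have hirr : Irreducible (C q * F) := (irreducible_isUnit_mul hqu).2 hF
  have hdeg' : (C q * F).totalDegree = 2 := by
    rw [totalDegree_mul_of_isDomain hqu.ne_zero hF.ne_zero, totalDegree_C, hdeg]
  have h1 : (ℓ - w).totalDegree ≤ 1 :=
    (totalDegree_sub _ _).trans (max_le h.linear.totalDegree_le hw)
  have h2 : (ℓ + w).totalDegree ≤ 1 :=
    (totalDegree_add _ _).trans (max_le h.linear.totalDegree_le hw)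
  have hne := hirr.ne_zero
  rw [hmul] at hirr hdeg' hne
  rw [totalDegree_mul_of_isDomain (left_ne_zero_of_mul hne) (right_ne_zero_of_mul hne)] at hdeg'
  rcases hirr.isUnit_or_isUnit rfl with hu | hu
  · have := (isUnit_iff_totalDegree_of_isReduced.1 hu).2
    omega
  · have := (isUnit_iff_totalDegree_of_isReduced.1 hu).2
    omega

theorem squarefree [IsAlgClosed k] (h : IsDiscriminant P F ℓ D q) (hF : Irreducible F)
    (hdeg : F.totalDegree = 2) : Squarefree D := by
  have hD0 : D ≠ 0 := by
    simpa using h.ne_sq hF hdeg (w := 0) (by simp)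
  rintro x ⟨y, hxy⟩
  have hx0 : x ≠ 0 := by rintro rfl; simp [hxy] at hD0
  have hy0 : y ≠ 0 := by rintro rfl; simp [hxy] at hD0
  have hd : D.totalDegree = 2 := h.quadratic.totalDegree hD0
  rw [hxy, totalDegree_mul_of_isDomain (mul_ne_zero hx0 hx0) hy0,
    totalDegree_mul_of_isDomain hx0 hx0] at hd
  rcases Nat.eq_zero_or_pos x.totalDegree with hx | hx
  · rw [totalDegree_eq_zero_iff_eq_C] at hx
    rw [hx] at hx0 ⊢
    exact (isUnit_iff_ne_zero.2 fun hc => hx0 (by rw [hc, map_zero])).map C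
  · exfalso
    -- A nonconstant x uses up the whole degree 2, so the cofactor is a constant, which has a square
    -- root e², and D = (ex)².
    have hy : y.totalDegree = 0 := by omega
    rw [totalDegree_eq_zero_iff_eq_C] at hy
    obtain ⟨e, he⟩ := IsAlgClosed.exists_pow_nat_eq (coeff 0 y) two_pos
    refine h.ne_sq hF hdeg (w := C e * x) ?_ ?_
    · refine (totalDegree_mul _ _).trans ?_
      rw [totalDegree_C]
      omega
    · rw [hxy, hy, ← he, C_pow]
      ring

theorem not_isUnit (h : IsDiscriminant P F ℓ D q) : ¬ IsUnit D := by
  intro hu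
  have h1 := (hu.map (eval (0 : Fin 3 → k))).ne_zero
  rw [eval_zero] at h1
  exact h1 (h.quadratic.coeff_eq_zero (d := 0) (by simp))

end IsDiscriminant

theorem not_mul_sq_eq_sq {R : Type*} [CommRing R] [IsDomain R] [UniqueFactorizationMonoid R]
    {D G H : R} (hD : Squarefree D) (hu : ¬ IsUnit D) (hH : H ≠ 0) : D * H ^ 2 ≠ G ^ 2 := by
  intro h
  have : H ∣ G := (UniqueFactorizationMonoid.pow_dvd_pow_iff_dvd two_ne_zero).1
    ⟨D, by rw [← h]; ring⟩
  obtain ⟨w, rfl⟩ := this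
  have hw : D = w * w := mul_right_cancel₀ (pow_ne_zero 2 hH) (by rw [h]; ring)
  have := hD w ⟨1, by rw [hw, mul_one]⟩
  exact hu (hw ▸ this.mul this)

/-- The quotient w = D'G/H is integral and w² = DD'. Since D is squarefree it divides w = Dv, so D'
= v²D, and squarefreeness of D' makes v a unit. -/
theorem exists_eq_unit_mul_of_mul_sq_eq {R : Type*} [CommRing R] [IsDomain R]
    [UniqueFactorizationMonoid R] {D D' G H : R} (hD : Squarefree D) (hD' : Squarefree D')
    (hH : H ≠ 0) (h : D * H ^ 2 = D' * G ^ 2) : ∃ v, IsUnit v ∧ D' = v * D := by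
  have hdvd : H ∣ D' * G := (UniqueFactorizationMonoid.pow_dvd_pow_iff_dvd two_ne_zero).1
    ⟨D * D', by linear_combination -D' * h⟩
  obtain ⟨w, hw⟩ := hdvd
  have hw2 : D * D' = w ^ 2 := mul_left_cancel₀ (pow_ne_zero 2 hH)
    (by linear_combination D' * h + (D' * G + H * w) * hw)
  have hDw : D ∣ w := (hD.dvd_pow_iff_dvd two_ne_zero).1 ⟨D', hw2.symm⟩
  obtain ⟨v, rfl⟩ := hDw
  have hD0 : D ≠ 0 := hD.ne_zero
  have hv : D' = v * v * D := mul_left_cancel₀ hD0 (by rw [hw2]; ring)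
  have hvu := hD' v ⟨D, hv⟩
  exact ⟨v * v, hvu.mul hvu, hv⟩

end Discriminant

/-! ### Generators of the function field over the pencil -/

section FunctionField

variable {k : Type*} [Field k]

theorem projectionPullback_mk {P : ℙ k (Fin 3 → k)} {C : IrreduciblePlaneCurve k}
    (hdom : ProjectionDominant P C) (x : pencilField P) (a b : pencilRing P)
    (hx : (x : FractionRing (pencilRing P)) =
      algebraMap _ (FractionRing (pencilRing P)) a / algebraMap _ (FractionRing (pencilRing P)) b) :
    (projectionPullback P C hdom x : FractionRing C.CoordRing) =
      algebraMap C.CoordRing _ (Ideal.Quotient.mk _ (a : MvPolynomial (Fin 3) k)) /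
      algebraMap C.CoordRing _ (Ideal.Quotient.mk _ (b : MvPolynomial (Fin 3) k)) := by
  have hinj : Function.Injective (projectionHom P C) := hdom
  change fracMap (projectionHom P C) hinj (x : FractionRing (pencilRing P)) = _
  rw [hx, map_div₀, fracMap_algebraMap, fracMap_algebraMap]
  rfl

/-- The quotient of two forms of the same degree as an element of `k(ℙ¹)`. -/
def pencilFraction {P : ℙ k (Fin 3 → k)} {n : ℕ} (G H : pencilRing P)
    (hG : (G : MvPolynomial (Fin 3) k).IsHomogeneous n)
    (hH : (H : MvPolynomial (Fin 3) k).IsHomogeneous n) (hH0 : H ≠ 0) : pencilField P :=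
  ⟨algebraMap _ (FractionRing (pencilRing P)) G / algebraMap _ (FractionRing (pencilRing P)) H,
    n, G, hG, H, hH, hH0, rfl⟩

/-- The quotient of two forms of the same degree as an element of `k(C)`. -/
def curveFraction {C : IrreduciblePlaneCurve k} {n : ℕ} (G H : MvPolynomial (Fin 3) k)
    (hG : G.IsHomogeneous n) (hH : H.IsHomogeneous n) (hH0 : ¬ C.form ∣ H) : C.functionField :=
  ⟨algebraMap C.CoordRing (FractionRing C.CoordRing) (Ideal.Quotient.mk _ G) /
    algebraMap C.CoordRing (FractionRing C.CoordRing) (Ideal.Quotient.mk _ H),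
    n, _, ⟨G, hG, rfl⟩, _, ⟨H, hH, rfl⟩, by
      change Ideal.Quotient.mk _ H ≠ 0
      rwa [Ne, Ideal.Quotient.eq_zero_iff_dvd], rfl⟩

namespace IsDiscriminant

variable {P : ℙ k (Fin 3 → k)} {C : IrreduciblePlaneCurve k} {ℓ D m : MvPolynomial (Fin 3) k}
  {q : k}

theorem projectionDominant [IsAlgClosed k] (h : IsDiscriminant P C.form ℓ D q) :
    ProjectionDominant P C := by
  rw [ProjectionDominant, injective_iff_map_eq_zero]
  intro G hG
  have hG' : Ideal.Quotient.mk (Ideal.span {C.form}) (G : MvPolynomial (Fin 3) k) = 0 := hG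
  rw [Ideal.Quotient.eq_zero_iff_dvd] at hG'
  exact Subtype.ext (h.eq_zero_of_dvd G.2 hG')

theorem not_dvd [IsAlgClosed k] (h : IsDiscriminant P C.form ℓ D q) (hm : m ∈ linearFormsAt P)
    (hm0 : m ≠ 0) : ¬ C.form ∣ m := fun hd =>
  hm0 (h.eq_zero_of_dvd (Algebra.subset_adjoin hm) hd)

/-- The field k(C) is generated by the X_i/m, and X_i - (p_i/q)ℓ vanishes at P, so X_i/m is an
element of k(ℙ¹) plus a multiple of ℓ/m. A bare `Subfield` serves both base fields used below: the
image of k(ℙ¹) in k(C), and k(ℙ¹) acting through the pullback. -/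
theorem subfield_eq_top [IsAlgClosed k] (h : IsDiscriminant P C.form ℓ D q)
    (hdom : ProjectionDominant P C) (hm : m ∈ linearFormsAt P) (hm0 : m ≠ 0)
    (S : Subfield C.functionField) (hS : ∀ f, projectionPullback P C hdom f ∈ S)
    (hu : curveFraction ℓ m h.linear hm.1 (h.not_dvd hm hm0) ∈ S) : S = ⊤ := by
  have hmm : (⟨m, Algebra.subset_adjoin hm⟩ : pencilRing P) ≠ 0 := fun h0 =>
    hm0 (congrArg Subtype.val h0)
  have hnd := h.not_dvd hm hm0
  have hk : ∀ r : k, algebraMap k C.functionField r ∈ S := fun r => by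
    rw [← (projectionPullback P C hdom).commutes]
    exact hS _
  set μ := algebraMap C.CoordRing (FractionRing C.CoordRing) (Ideal.Quotient.mk _ m) with hμ
  have hμ0 : μ ≠ 0 := by
    rw [hμ, Ne, map_eq_zero_iff _ (IsFractionRing.injective _ _), Ideal.Quotient.eq_zero_iff_dvd]
    exact hnd
  let y : Fin 3 → C.functionField := fun i => curveFraction (X i) m (isHomogeneous_X k i) hm.1 hnd
  have hy : ∀ i, y i ∈ S := by
    intro i
    have hlin : X i - MvPolynomial.C (P.rep i / q) * ℓ ∈ linearFormsAt P := by
      refine ⟨(isHomogeneous_X k i).sub ?_, ?_⟩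
      · simpa using (isHomogeneous_C (Fin 3) (P.rep i / q)).mul h.linear
      · simp [h.eval_linear, h.ne_zero]
    let f : pencilField P := pencilFraction ⟨_, Algebra.subset_adjoin hlin⟩
      ⟨m, Algebra.subset_adjoin hm⟩ hlin.1 hm.1 hmm
    have hyi : y i = projectionPullback P C hdom f + algebraMap k C.functionField (P.rep i / q) *
        curveFraction ℓ m h.linear hm.1 hnd := by
      refine Subtype.ext ?_
      rw [IntermediateField.coe_add, IntermediateField.coe_mul, projectionPullback_mk hdom f _ _ rfl]
      have h2 : ((algebraMap k C.functionField (P.rep i / q) : C.functionField) :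
          FractionRing C.CoordRing) = algebraMap C.CoordRing (FractionRing C.CoordRing)
            (Ideal.Quotient.mk _ (MvPolynomial.C (P.rep i / q))) := by
        exact IsScalarTower.algebraMap_apply k C.CoordRing (FractionRing C.CoordRing) _
      rw [h2]
      simp only [y, curveFraction, map_sub, map_mul]
      ring
    rw [hyi]
    exact add_mem (hS _) (mul_mem (hk _) hu)
  have hpoly : ∀ G : MvPolynomial (Fin 3) k, aeval y G ∈ S := by
    intro G
    induction G using MvPolynomial.induction_on with
    | C a => rw [aeval_C]; exact hk a
    | add G H hG hH => rw [map_add]; exact add_mem hG hH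
    | mul_X G i hG => rw [map_mul, aeval_X]; exact mul_mem hG (hy i)
  -- Dehomogenization by m; the factor m^n then cancels in quotients of forms of equal degree.
  have hval : ∀ (n : ℕ) (G : MvPolynomial (Fin 3) k), G.IsHomogeneous n →
      ((aeval y G : C.functionField) : FractionRing C.CoordRing) =
        algebraMap C.CoordRing (FractionRing C.CoordRing) (Ideal.Quotient.mk _ G) / μ ^ n := by
    intro n G hG
    have h1 : ((aeval y G : C.functionField) : FractionRing C.CoordRing) =
        aeval (fun i => (y i : FractionRing C.CoordRing)) G := by
      exact (comp_aeval_apply y C.functionField.val G)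
    have h2 : ∀ G : MvPolynomial (Fin 3) k,
        algebraMap C.CoordRing (FractionRing C.CoordRing) (Ideal.Quotient.mk _ G) =
        aeval (fun i => algebraMap C.CoordRing (FractionRing C.CoordRing)
          (Ideal.Quotient.mk _ (X i))) G := by
      intro G
      exact (DFunLike.congr_fun (aeval_unique (((IsScalarTower.toAlgHom k C.CoordRing
        (FractionRing C.CoordRing)).comp (Ideal.Quotient.mkₐ k _)))) G)
    rw [h1, h2, ← aeval_div_of_isHomogeneous hG]
    rfl
  rw [eq_top_iff]
  rintro ⟨x, n, _, ⟨G, hG, rfl⟩, _, ⟨H, hH, rfl⟩, hH0, hx⟩ -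
  have hxe : (⟨x, n, _, ⟨G, hG, rfl⟩, _, ⟨H, hH, rfl⟩, hH0, hx⟩ : C.functionField) =
      aeval y G / aeval y H := by
    refine Subtype.ext ?_
    rw [IntermediateField.coe_div, hval n G hG, hval n H hH, div_div_div_cancel_right₀
      (pow_ne_zero n hμ0)]
    exact hx
  rw [hxe]
  exact div_mem (hpoly G) (hpoly H)

end IsDiscriminant

end FunctionField

/-! ### Isomorphic function fields and proportional discriminants -/

section SimultaneousGalois

open IntermediateField

variable {k : Type*} [Field k]

/-- The fraction `D / m²` in `k(ℙ¹)`, for a quadratic form `D` and a linear form `m`. -/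
def quadraticFraction {P : ℙ k (Fin 3 → k)} {D m : MvPolynomial (Fin 3) k}
    (hD : D ∈ pencilRing P) (hD2 : D.IsHomogeneous 2) (hm : m ∈ linearFormsAt P) (hm0 : m ≠ 0) :
    pencilField P :=
  pencilFraction ⟨D, hD⟩ (⟨m, Algebra.subset_adjoin hm⟩ ^ 2) hD2 (by simpa using hm.1.pow 2)
    (pow_ne_zero 2 fun h0 => hm0 (congrArg Subtype.val h0))

theorem quadraticFraction_ne_zero {P : ℙ k (Fin 3 → k)} {D m : MvPolynomial (Fin 3) k}
    (hD : D ∈ pencilRing P) (hD2 : D.IsHomogeneous 2) (hm : m ∈ linearFormsAt P) (hm0 : m ≠ 0)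
    (hD0 : D ≠ 0) : quadraticFraction hD hD2 hm hm0 ≠ 0 := by
  intro h
  have h1 := congrArg Subtype.val h
  have hinj := IsFractionRing.injective (pencilRing P) (FractionRing (pencilRing P))
  rcases div_eq_zero_iff.1 h1 with h2 | h2
  · exact hD0 (congrArg Subtype.val ((map_eq_zero_iff _ hinj).1 h2))
  · exact pow_ne_zero 2 (fun h0 => hm0 (congrArg Subtype.val h0)) ((map_eq_zero_iff _ hinj).1 h2)

theorem quadraticFraction_sq {P : ℙ k (Fin 3 → k)} {m : MvPolynomial (Fin 3) k}
    (hm : m ∈ linearFormsAt P) (hm0 : m ≠ 0) (hD : m ^ 2 ∈ pencilRing P)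
    (hD2 : (m ^ 2).IsHomogeneous 2) : quadraticFraction hD hD2 hm hm0 = 1 := by
  have hne : (⟨m, Algebra.subset_adjoin hm⟩ : pencilRing P) ^ 2 ≠ 0 :=
    pow_ne_zero 2 fun h0 => hm0 (congrArg Subtype.val h0)
  have heq : (⟨m ^ 2, hD⟩ : pencilRing P) = ⟨m, Algebra.subset_adjoin hm⟩ ^ 2 := rfl
  refine Subtype.ext ?_
  simp only [quadraticFraction, pencilFraction, heq]
  exact div_self fun h0 =>
    hne ((map_eq_zero_iff _ (IsFractionRing.injective _ (FractionRing (pencilRing P)))).1 h0)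

theorem exists_mul_sq_eq_of_quadraticFraction {P : ℙ k (Fin 3 → k)}
    {D D' m : MvPolynomial (Fin 3) k} (hD : D ∈ pencilRing P) (hD2 : D.IsHomogeneous 2)
    (hD' : D' ∈ pencilRing P) (hD2' : D'.IsHomogeneous 2) (hm : m ∈ linearFormsAt P) (hm0 : m ≠ 0)
    {b : pencilField P}
    (h : quadraticFraction hD hD2 hm hm0 = b ^ 2 * quadraticFraction hD' hD2' hm hm0) :
    ∃ G H : MvPolynomial (Fin 3) k, H ≠ 0 ∧ D * H ^ 2 = D' * G ^ 2 := by
  obtain ⟨x, n, G, hG, H, hH, hH0, rfl⟩ := b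
  refine ⟨G, H, fun h0 => hH0 (Subtype.ext h0), ?_⟩
  have h1 := congrArg Subtype.val h
  rw [IntermediateField.coe_mul, IntermediateField.coe_pow] at h1
  simp only [quadraticFraction, pencilFraction] at h1
  have hinj := IsFractionRing.injective (pencilRing P) (FractionRing (pencilRing P))
  have hH' : algebraMap (pencilRing P) (FractionRing (pencilRing P)) H ≠ 0 := by
    rwa [Ne, map_eq_zero_iff _ hinj]
  have hm' : algebraMap (pencilRing P) (FractionRing (pencilRing P))
      (⟨m, Algebra.subset_adjoin hm⟩ ^ 2) ≠ 0 := by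
    rw [Ne, map_eq_zero_iff _ hinj]
    exact pow_ne_zero 2 fun h0 => hm0 (congrArg Subtype.val h0)
  rw [← mul_div_assoc, div_left_inj' hm', div_pow, div_mul_eq_mul_div,
    eq_div_iff (pow_ne_zero 2 hH'), ← map_pow, ← map_pow, ← map_mul, ← map_mul] at h1
  have h2 := congrArg Subtype.val (hinj h1)
  simp only [MulMemClass.coe_mul, SubmonoidClass.coe_pow] at h2
  rw [h2, mul_comm]

namespace IsDiscriminant

variable {P : ℙ k (Fin 3 → k)} {C : IrreduciblePlaneCurve k} {ℓ D m : MvPolynomial (Fin 3) k}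
  {q : k}

/-- D and ℓ² differ by a multiple of F. -/
theorem sq_curveFraction [IsAlgClosed k] (h : IsDiscriminant P C.form ℓ D q)
    (hdom : ProjectionDominant P C) (hm : m ∈ linearFormsAt P) (hm0 : m ≠ 0) :
    curveFraction ℓ m h.linear hm.1 (h.not_dvd hm hm0) ^ 2 =
      projectionPullback P C hdom (quadraticFraction h.mem h.quadratic hm hm0) := by
  refine Subtype.ext ?_
  rw [IntermediateField.coe_pow, projectionPullback_mk hdom _ _ _ rfl]
  have h1 : Ideal.Quotient.mk (Ideal.span {C.form}) D =
      Ideal.Quotient.mk (Ideal.span {C.form}) ℓ ^ 2 := by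
    rw [← map_pow, Ideal.Quotient.eq, Ideal.mem_span_singleton, h.eq]
    exact ⟨-MvPolynomial.C q, by ring⟩
  rw [h1]
  simp only [curveFraction, div_pow, SubmonoidClass.coe_pow, map_pow]

theorem isGalois [IsAlgClosed k] [CharZero k] (h : IsDiscriminant P C.form ℓ D q) (hD0 : D ≠ 0)
    (hdom : ProjectionDominant P C) :
    IsGalois (projectionPullback P C hdom).fieldRange C.functionField := by
  obtain ⟨m, hm, hm0⟩ := exists_linearForm_ne_zero P
  set d := quadraticFraction h.mem h.quadratic hm hm0
  have : CharZero (projectionPullback P C hdom).fieldRange :=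
    charZero_of_injective_algebraMap
      (algebraMap k (projectionPullback P C hdom).fieldRange).injective
  have hsq := h.sq_curveFraction hdom hm hm0
  refine isGalois_of_sq_eq (d := ⟨projectionPullback P C hdom d, d, rfl⟩) ?_ hsq ?_
  · intro h0
    have h1 : projectionPullback P C hdom d = 0 := congrArg Subtype.val h0
    exact quadraticFraction_ne_zero h.mem h.quadratic hm hm0 hD0
      ((map_eq_zero_iff _ (projectionPullback P C hdom).injective).1 h1)
  · rw [eq_top_iff]
    intro x _
    have := h.subfield_eq_top hdom hm hm0
      ((projectionPullback P C hdom).fieldRange⟮curveFraction ℓ m h.linear hm.1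
        (h.not_dvd hm hm0)⟯).toSubfield
      (fun f => IntermediateField.algebraMap_mem _
        (⟨projectionPullback P C hdom f, f, rfl⟩ : (projectionPullback P C hdom).fieldRange))
      (mem_adjoin_simple_self _ _)
    have hx : x ∈ (⊤ : Subfield C.functionField) := Subfield.mem_top x
    rwa [← this] at hx

theorem adjoin_eq_top [IsAlgClosed k] (h : IsDiscriminant P C.form ℓ D q)
    (hdom : ProjectionDominant P C) (hm : m ∈ linearFormsAt P) (hm0 : m ≠ 0) :
    letI := (projectionPullback P C hdom).toRingHom.toAlgebra
    (pencilField P)⟮curveFraction ℓ m h.linear hm.1 (h.not_dvd hm hm0)⟯ = ⊤ := by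
  let _ := (projectionPullback P C hdom).toRingHom.toAlgebra
  rw [eq_top_iff]
  intro x _
  have := h.subfield_eq_top hdom hm hm0
    ((pencilField P)⟮curveFraction ℓ m h.linear hm.1 (h.not_dvd hm hm0)⟯).toSubfield
    (fun f => IntermediateField.algebraMap_mem _ f) (mem_adjoin_simple_self _ _)
  have hx : x ∈ (⊤ : Subfield C.functionField) := Subfield.mem_top x
  rwa [← this] at hx

variable {C' : IrreduciblePlaneCurve k} {ℓ' D' : MvPolynomial (Fin 3) k} {q' : k}

theorem exists_ringEquiv [IsAlgClosed k]
    (h : IsDiscriminant P C.form ℓ D q) (h' : IsDiscriminant P C'.form ℓ' D' q')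
    (hdom : ProjectionDominant P C) (hdom' : ProjectionDominant P C') {c : k} (hc : c ≠ 0)
    (hD : D = MvPolynomial.C c * D') :
    ∃ φ : C.functionField ≃+* C'.functionField,
      ∀ f : pencilField P, φ (projectionPullback P C hdom f) = projectionPullback P C' hdom' f := by
  obtain ⟨m, hm, hm0⟩ := exists_linearForm_ne_zero P
  -- Constants are squares, so proportional discriminants have the same square class.
  obtain ⟨e, he⟩ := IsAlgClosed.exists_pow_nat_eq c two_pos
  let _ := (projectionPullback P C hdom).toRingHom.toAlgebra
  let _ := (projectionPullback P C' hdom').toRingHom.toAlgebra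
  have hd : quadraticFraction h.mem h.quadratic hm hm0 =
      algebraMap k (pencilField P) e ^ 2 * quadraticFraction h'.mem h'.quadratic hm hm0 := by
    refine Subtype.ext ?_
    rw [← map_pow, he, IntermediateField.coe_mul]
    have h2 : ((algebraMap k (pencilField P) c : pencilField P) : FractionRing (pencilRing P)) =
        algebraMap (pencilRing P) (FractionRing (pencilRing P)) (algebraMap k (pencilRing P) c) :=
      IsScalarTower.algebraMap_apply k (pencilRing P) (FractionRing (pencilRing P)) c
    rw [h2]
    simp only [quadraticFraction, pencilFraction]
    rw [← mul_div_assoc, ← map_mul]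
    congr 2
    exact Subtype.ext hD
  obtain ⟨φ⟩ := nonempty_algEquiv_of_sq_eq (h.sq_curveFraction hdom hm hm0)
    (h.adjoin_eq_top hdom hm hm0) (h'.sq_curveFraction hdom' hm hm0)
    (h'.adjoin_eq_top hdom' hm hm0) (e := algebraMap k (pencilField P) e)
    (by rw [Ne, map_eq_zero]; rintro rfl; exact hc (by rw [← he]; simp)) hd
  exact ⟨φ.toRingEquiv, fun f => φ.commutes f⟩

theorem exists_eq_C_mul [IsAlgClosed k] [CharZero k]
    (h : IsDiscriminant P C.form ℓ D q) (h' : IsDiscriminant P C'.form ℓ' D' q')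
    (hdeg : C.form.totalDegree = 2) (hdeg' : C'.form.totalDegree = 2)
    (hdom : ProjectionDominant P C) (hdom' : ProjectionDominant P C')
    (φ : C.functionField ≃+* C'.functionField)
    (hφ : ∀ f : pencilField P,
      φ (projectionPullback P C hdom f) = projectionPullback P C' hdom' f) :
    ∃ c, c ≠ 0 ∧ D' = MvPolynomial.C c * D := by
  obtain ⟨m, hm, hm0⟩ := exists_linearForm_ne_zero P
  have hDs := h.squarefree C.irreducible hdeg
  have hDs' := h'.squarefree C'.irreducible hdeg'
  have hone : (m ^ 2) ∈ pencilRing P := pow_mem (Algebra.subset_adjoin hm) 2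
  have hone2 : (m ^ 2).IsHomogeneous 2 := by simpa using hm.1.pow 2
  -- If E/m² = (G/H)², then EH² = (mG)², impossible for a squarefree nonunit E. Comparing with the
  -- fraction m²/m² = 1 reuses the lemma on clearing denominators.
  have hnsq : ∀ {E : MvPolynomial (Fin 3) k} (hE : E ∈ pencilRing P) (hE2 : E.IsHomogeneous 2),
      Squarefree E → ¬ IsUnit E → ¬ IsSquare (quadraticFraction hE hE2 hm hm0) := by
    rintro E hE hE2 hs hu ⟨b, hb⟩
    obtain ⟨G, H, hH, hGH⟩ := exists_mul_sq_eq_of_quadraticFraction hE hE2 hone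
      hone2 hm hm0 (b := b) (by rw [quadraticFraction_sq hm hm0 hone hone2, mul_one, hb, sq])
    exact not_mul_sq_eq_sq hs hu hH (G := m * G) (by rw [hGH]; ring)
  let _ := (projectionPullback P C hdom).toRingHom.toAlgebra
  let _ := (projectionPullback P C' hdom').toRingHom.toAlgebra
  have : CharZero (pencilField P) :=
    charZero_of_injective_algebraMap (algebraMap k (pencilField P)).injective
  let ψ : C.functionField →ₐ[pencilField P] C'.functionField :=
    { φ.toRingHom with commutes' := hφ }
  rcases isSquare_or_of_algEquiv (h.sq_curveFraction hdom hm hm0)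
    (h'.sq_curveFraction hdom' hm hm0) (h'.adjoin_eq_top hdom' hm hm0) ψ with hs | hs | ⟨b, hb⟩
  · exact absurd hs (hnsq _ _ hDs h.not_isUnit)
  · exact absurd hs (hnsq _ _ hDs' h'.not_isUnit)
  · obtain ⟨G, H, hH, hGH⟩ := exists_mul_sq_eq_of_quadraticFraction h.mem h.quadratic h'.mem
      h'.quadratic hm hm0 hb
    obtain ⟨v, hv, hDv⟩ := exists_eq_unit_mul_of_mul_sq_eq hDs hDs' hH hGH
    obtain ⟨c, hc, rfl⟩ := isUnit_iff_eq_C_of_isReduced.1 hv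
    exact ⟨c, hc.ne_zero, hDv⟩

end IsDiscriminant

theorem isSGPoint_iff [IsAlgClosed k] [CharZero k] {ι : Type*} {C : ι → IrreduciblePlaneCurve k}
    (hdeg : ∀ i, (C i).degree = 2) {P : ℙ k (Fin 3 → k)} {ℓ D : ι → MvPolynomial (Fin 3) k}
    {q : ι → k} (h : ∀ i, IsDiscriminant P (C i).form (ℓ i) (D i) (q i)) :
    IsSGPoint C P ↔ ∀ i j, ∃ c, c ≠ 0 ∧ D i = MvPolynomial.C c * D j := by
  constructor
  · rintro ⟨hdom, -, hiso⟩ i j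
    obtain ⟨φ, hφ⟩ := hiso j i
    exact (h j).exists_eq_C_mul (h i) (hdeg j) (hdeg i) (hdom j) (hdom i) φ hφ
  · intro hD
    refine ⟨fun i => (h i).projectionDominant, fun i => (h i).isGalois
      ((h i).squarefree (C i).irreducible (hdeg i)).ne_zero _, fun i j => ?_⟩
    obtain ⟨c, hc, hcD⟩ := hD i j
    exact (h i).exists_ringEquiv (h j) _ _ hc hcD

end SimultaneousGalois

/-! ### Symmetric bilinear forms on three-space and their isotropic vectors -/

section TernaryForms

open Matrix

variable {k : Type*} [Field k]

/-- The bilinear form with matrix `N`. -/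
def bil (N : Matrix (Fin 3) (Fin 3) k) (u v : Fin 3 → k) : k := u ⬝ᵥ N.mulVec v

variable (N : Matrix (Fin 3) (Fin 3) k)

theorem bil_add_left (u v w : Fin 3 → k) : bil N (u + v) w = bil N u w + bil N v w :=
  add_dotProduct _ _ _

theorem bil_add_right (u v w : Fin 3 → k) : bil N u (v + w) = bil N u v + bil N u w := by
  rw [bil, mulVec_add, dotProduct_add]; rfl

theorem bil_smul_left (a : k) (u v : Fin 3 → k) : bil N (a • u) v = a * bil N u v :=
  smul_dotProduct _ _ _

theorem bil_smul_right (a : k) (u v : Fin 3 → k) : bil N u (a • v) = a * bil N u v := by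
  rw [bil, mulVec_smul, dotProduct_smul]; rfl

variable {N}

theorem bil_comm (hN : N.IsSymm) (u v : Fin 3 → k) : bil N u v = bil N v u := by
  rw [bil, bil, dotProduct_mulVec, ← mulVec_transpose, hN.eq, dotProduct_comm]

theorem bil_add_self (hN : N.IsSymm) (u v : Fin 3 → k) :
    bil N (u + v) (u + v) = bil N u u + 2 * bil N u v + bil N v v := by
  rw [bil_add_left, bil_add_right, bil_add_right, bil_comm hN v u]; ring

theorem bil_combo_two (hN : N.IsSymm) (a b : k) (u v : Fin 3 → k) :
    bil N (a • u + b • v) (a • u + b • v) =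
      a ^ 2 * bil N u u + 2 * (a * b * bil N u v) + b ^ 2 * bil N v v := by
  simp only [bil_add_self hN, bil_smul_left, bil_smul_right]; ring

theorem bil_combo_three (hN : N.IsSymm) (a b c : k) (u v w : Fin 3 → k) :
    bil N (a • u + b • v + c • w) (a • u + b • v + c • w) =
      a ^ 2 * bil N u u + b ^ 2 * bil N v v + c ^ 2 * bil N w w +
        2 * (b * c * bil N v w + a * c * bil N u w + a * b * bil N u v) := by
  simp only [bil_add_self hN, bil_add_left, bil_smul_left, bil_smul_right]; ring

/-- The Gram determinant of u, v is the dual form at the line they span. Everything about duality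
below rests on this identity. -/
theorem bil_adjugate_cross (hN : N.IsSymm) (u v : Fin 3 → k) :
    bil N.adjugate (crossProduct u v) (crossProduct u v) =
      bil N u u * bil N v v - bil N u v ^ 2 := by
  have h1 := hN.apply 0 1
  have h2 := hN.apply 0 2
  have h3 := hN.apply 1 2
  simp only [bil, adjugate_fin_three, cross_apply, dotProduct, mulVec, Fin.sum_univ_three]
  simp [h1, h2, h3]
  ring

theorem det_mul_triple_sq (N : Matrix (Fin 3) (Fin 3) k) (u v w : Fin 3 → k) :
    N.det * (crossProduct u v ⬝ᵥ w) ^ 2 =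
      (Matrix.of fun i j => bil N (![u, v, w] i) (![u, v, w] j)).det := by
  have h : (Matrix.of fun i j => bil N (![u, v, w] i) (![u, v, w] j)) =
      Matrix.of ![u, v, w] * N * (Matrix.of ![u, v, w])ᵀ := by
    ext i j
    rw [Matrix.mul_assoc, Matrix.mul_apply']
    rfl
  have h2 : (Matrix.of ![u, v, w]).det = crossProduct u v ⬝ᵥ w := by
    rw [det_fin_three]
    simp [cross_apply, dotProduct, Fin.sum_univ_three]
    ring
  rw [h, det_mul, det_mul, det_transpose, h2]
  ring

/-- Cramer's rule for four vectors in three-space. When u, v, w are dependent, the auxiliary e still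
gives the coefficients of w. -/
theorem cross_smul_eq_combo (u v w e : Fin 3 → k) :
    (crossProduct u v ⬝ᵥ e) • w = (crossProduct w v ⬝ᵥ e) • u + (crossProduct u w ⬝ᵥ e) • v +
      (crossProduct u v ⬝ᵥ w) • e := by
  ext i
  fin_cases i <;> simp [cross_apply, dotProduct, Fin.sum_univ_three] <;> ring

theorem exists_combo_three {u v w : Fin 3 → k} (h : crossProduct u v ⬝ᵥ w ≠ 0) (x : Fin 3 → k) :
    ∃ a b c : k, x = a • u + b • v + c • w := by
  refine ⟨(crossProduct u v ⬝ᵥ w)⁻¹ * (crossProduct x v ⬝ᵥ w),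
    (crossProduct u v ⬝ᵥ w)⁻¹ * (crossProduct u x ⬝ᵥ w),
    (crossProduct u v ⬝ᵥ w)⁻¹ * (crossProduct u v ⬝ᵥ x), ?_⟩
  simp only [mul_smul, ← smul_add]
  rw [← cross_smul_eq_combo, smul_smul, inv_mul_cancel₀ h, one_smul]

theorem exists_dotProduct_ne_zero {p : Fin 3 → k} (hp : p ≠ 0) : ∃ e, p ⬝ᵥ e ≠ 0 := by
  by_contra! h
  exact hp (dotProduct_eq_zero_iff.1 h)

theorem exists_combo_two {u v w : Fin 3 → k} (huv : crossProduct u v ≠ 0)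
    (h : crossProduct u v ⬝ᵥ w = 0) : ∃ a b : k, w = a • u + b • v := by
  obtain ⟨e, he⟩ := exists_dotProduct_ne_zero huv
  refine ⟨(crossProduct u v ⬝ᵥ e)⁻¹ * (crossProduct w v ⬝ᵥ e),
    (crossProduct u v ⬝ᵥ e)⁻¹ * (crossProduct u w ⬝ᵥ e), ?_⟩
  have h1 := cross_smul_eq_combo u v w e
  rw [h, zero_smul, add_zero] at h1
  rw [mul_smul, mul_smul, ← smul_add, ← h1, smul_smul, inv_mul_cancel₀ he, one_smul]

theorem exists_eq_cross {p w : Fin 3 → k} (hp : p ≠ 0) (h : p ⬝ᵥ w = 0) :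
    ∃ x, w = crossProduct p x := by
  obtain ⟨e, he⟩ := exists_dotProduct_ne_zero hp
  refine ⟨(p ⬝ᵥ e)⁻¹ • crossProduct w e, ?_⟩
  have h1 : crossProduct p (crossProduct w e) = (p ⬝ᵥ e) • w - (p ⬝ᵥ w) • e := by
    ext i
    fin_cases i <;> simp [cross_apply, dotProduct, Fin.sum_univ_three] <;> ring
  rw [map_smul, h1, h, zero_smul, sub_zero, smul_smul, inv_mul_cancel₀ he, one_smul]

theorem exists_cross_eq_smul {p : Fin 3 → k} (hp : p ≠ 0) :
    ∃ (u v : Fin 3 → k) (c : k), c ≠ 0 ∧ p ⬝ᵥ u = 0 ∧ p ⬝ᵥ v = 0 ∧ crossProduct u v = c • p := by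
  have key : ∀ x y : Fin 3 → k, p ⬝ᵥ crossProduct x y ≠ 0 →
      ∃ (u v : Fin 3 → k) (c : k), c ≠ 0 ∧ p ⬝ᵥ u = 0 ∧ p ⬝ᵥ v = 0 ∧ crossProduct u v = c • p := by
    intro x y h
    refine ⟨crossProduct p x, crossProduct p y, _, h, dot_self_cross _ _, dot_self_cross _ _, ?_⟩
    ext i
    fin_cases i <;> simp [cross_apply, dotProduct, Fin.sum_univ_three] <;> ring
  obtain ⟨i, hi⟩ := Function.ne_iff.1 hp
  fin_cases i
  · exact key ![0, 1, 0] ![0, 0, 1] (by simpa [cross_apply, dotProduct, Fin.sum_univ_three] using hi)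
  · exact key ![0, 0, 1] ![1, 0, 0] (by simpa [cross_apply, dotProduct, Fin.sum_univ_three] using hi)
  · exact key ![1, 0, 0] ![0, 1, 0] (by simpa [cross_apply, dotProduct, Fin.sum_univ_three] using hi)

theorem exists_cross_eq_smul_of_orthogonal {p u v : Fin 3 → k} (hp : p ≠ 0)
    (huv : crossProduct u v ≠ 0) (hu : p ⬝ᵥ u = 0) (hv : p ⬝ᵥ v = 0) :
    ∃ c : k, c ≠ 0 ∧ crossProduct u v = c • p := by
  have h : crossProduct (crossProduct u v) p = 0 := by
    have h1 : crossProduct (crossProduct u v) p = (p ⬝ᵥ u) • v - (p ⬝ᵥ v) • u := by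
      ext i
      fin_cases i <;> simp [cross_apply, dotProduct, Fin.sum_univ_three] <;> ring
    rw [h1, hu, hv, zero_smul, zero_smul, sub_zero]
  obtain ⟨c, hc⟩ := (Projectivization.mk_eq_mk_iff' k _ _ huv hp).1
    ((Projectivization.mk_eq_mk_iff_crossProduct_eq_zero huv hp).2 h)
  exact ⟨c, fun h0 => huv (by rw [← hc, h0, zero_smul]), hc.symm⟩

/-- Otherwise u and v span a totally isotropic plane, so the Gram determinant of u, v, w vanishes
for every w, against nondegeneracy. -/
theorem bil_ne_zero_of_isotropic (hN : N.IsSymm) (hdet : N.det ≠ 0) {u v : Fin 3 → k}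
    (huv : crossProduct u v ≠ 0) (hu : bil N u u = 0) (hv : bil N v v = 0) : bil N u v ≠ 0 := by
  intro h
  obtain ⟨w, hw⟩ := exists_dotProduct_ne_zero huv
  have h1 := det_mul_triple_sq N u v w
  refine mul_ne_zero hdet (pow_ne_zero 2 hw) (h1.trans ?_)
  rw [det_fin_three]
  simp [hu, hv, h, bil_comm hN v u]

theorem eq_zero_or_eq_zero_of_isotropic [CharZero k] (hN : N.IsSymm) (hdet : N.det ≠ 0)
    {u v : Fin 3 → k} (huv : crossProduct u v ≠ 0) (hu : bil N u u = 0) (hv : bil N v v = 0)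
    {a b : k} (hw : bil N (a • u + b • v) (a • u + b • v) = 0) : a = 0 ∨ b = 0 := by
  rw [bil_combo_two hN, hu, hv, mul_zero, mul_zero, zero_add, add_zero] at hw
  simpa [bil_ne_zero_of_isotropic hN hdet huv hu hv] using hw

/-- A line meets a nonsingular conic in at most two points. -/
theorem triple_ne_zero_of_isotropic [CharZero k] (hN : N.IsSymm) (hdet : N.det ≠ 0)
    {u v w : Fin 3 → k} (huv : crossProduct u v ≠ 0) (huw : crossProduct u w ≠ 0)
    (hvw : crossProduct v w ≠ 0) (hu : bil N u u = 0) (hv : bil N v v = 0) (hw : bil N w w = 0) :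
    crossProduct u v ⬝ᵥ w ≠ 0 := by
  intro h
  obtain ⟨a, b, rfl⟩ := exists_combo_two huv h
  rcases eq_zero_or_eq_zero_of_isotropic hN hdet huv hu hv hw with rfl | rfl
  · simp at hvw
  · simp at huw

/-- By the Gram identity the restriction of `N` to p^⊥ has nonzero discriminant; its two zeros come
from the quadratic formula. -/
theorem exists_isotropic_pair [IsAlgClosed k] [CharZero k] (hN : N.IsSymm) {p : Fin 3 → k}
    (hp : bil N.adjugate p p ≠ 0) :
    ∃ u v : Fin 3 → k, p ⬝ᵥ u = 0 ∧ p ⬝ᵥ v = 0 ∧ crossProduct u v ≠ 0 ∧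
      bil N u u = 0 ∧ bil N v v = 0 := by
  have hp0 : p ≠ 0 := by rintro rfl; simp [bil] at hp
  obtain ⟨e, f, c, hc, he, hf, hef⟩ := exists_cross_eq_smul hp0
  have hgram := bil_adjugate_cross hN e f
  rw [hef, bil_smul_left, bil_smul_right] at hgram
  have hdisc : bil N e e * bil N f f - bil N e f ^ 2 ≠ 0 := by
    rw [← hgram]; exact mul_ne_zero hc (mul_ne_zero hc hp)
  have hcross : ∀ a b a' b' : k, crossProduct (a • e + b • f) (a' • e + b' • f) =
      ((a * b' - b * a') * c) • p := by
    intro a b a' b'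
    rw [mul_smul, ← hef]
    ext i
    fin_cases i <;> simp [cross_apply] <;> ring
  have horth : ∀ a b : k, p ⬝ᵥ (a • e + b • f) = 0 := by
    intro a b
    rw [dotProduct_add, dotProduct_smul, dotProduct_smul, he, hf, smul_zero, smul_zero, add_zero]
  by_cases hA : bil N e e = 0
  · have hB : bil N e f ≠ 0 := by
      intro hB; simp [hA, hB] at hdisc
    -- With N(e, e) = 0 the binary form is b(2aN(e, f) + bN(f, f)); these are the zeros of its two
    -- factors.
    refine ⟨(1 : k) • e + (0 : k) • f, bil N f f • e + (-2 * bil N e f) • f, horth _ _, horth _ _,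
      ?_, ?_, ?_⟩
    · rw [hcross]
      refine smul_ne_zero (mul_ne_zero ?_ hc) hp0
      simp [hB]
    · rw [bil_combo_two hN, hA]; ring
    · rw [bil_combo_two hN, hA]; ring
  · obtain ⟨s, hs⟩ := IsAlgClosed.exists_pow_nat_eq
      (bil N e f ^ 2 - bil N e e * bil N f f) two_pos
    have hs0 : s ≠ 0 := by
      rintro rfl
      exact hdisc (by linear_combination hs)
    refine ⟨(s - bil N e f) • e + bil N e e • f, (-s - bil N e f) • e + bil N e e • f,
      horth _ _, horth _ _, ?_, ?_, ?_⟩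
    · rw [hcross]
      refine smul_ne_zero (mul_ne_zero ?_ hc) hp0
      have : (s - bil N e f) * bil N e e - bil N e e * (-s - bil N e f) = 2 * s * bil N e e := by
        ring
      rw [this]
      exact mul_ne_zero (mul_ne_zero two_ne_zero hs0) hA
    · rw [bil_combo_two hN]; linear_combination bil N e e * hs
    · rw [bil_combo_two hN]; linear_combination bil N e e * hs

/-- On the span of u and v each form is 2ab times its value at (u, v). -/
theorem exists_bil_eq_mul_of_isotropic_pair [CharZero k] {N N' : Matrix (Fin 3) (Fin 3) k}
    (hN : N.IsSymm) (hdet : N.det ≠ 0) (hN' : N'.IsSymm) (hdet' : N'.det ≠ 0) {u v : Fin 3 → k}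
    (huv : crossProduct u v ≠ 0) (hu : bil N u u = 0) (hv : bil N v v = 0) (hu' : bil N' u u = 0)
    (hv' : bil N' v v = 0) :
    ∃ c : k, c ≠ 0 ∧ ∀ w, crossProduct u v ⬝ᵥ w = 0 → bil N w w = c * bil N' w w := by
  have h := bil_ne_zero_of_isotropic hN hdet huv hu hv
  have h' := bil_ne_zero_of_isotropic hN' hdet' huv hu' hv'
  refine ⟨bil N u v / bil N' u v, div_ne_zero h h', fun w hw => ?_⟩
  obtain ⟨a, b, rfl⟩ := exists_combo_two huv hw
  rw [bil_combo_two hN, bil_combo_two hN', hu, hv, hu', hv']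
  field_simp
  ring

/-- Five points determine a nonsingular conic. No three are collinear, so the first three form a
basis, in which a form through them has only the mixed coefficients a, b, c. The other two points
impose two independent linear conditions on (a, b, c). -/
theorem exists_bil_eq_mul_of_five_isotropic [CharZero k] {N N' : Matrix (Fin 3) (Fin 3) k}
    (hN : N.IsSymm) (hdet : N.det ≠ 0) (hN' : N'.IsSymm) (hdet' : N'.det ≠ 0)
    {z : Fin 5 → Fin 3 → k} (hz : ∀ i j, i ≠ j → crossProduct (z i) (z j) ≠ 0)
    (h : ∀ i, bil N (z i) (z i) = 0) (h' : ∀ i, bil N' (z i) (z i) = 0) :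
    ∃ c : k, c ≠ 0 ∧ ∀ w, bil N w w = c * bil N' w w := by
  have htriple : ∀ i j l, i ≠ j → i ≠ l → j ≠ l → crossProduct (z i) (z j) ⬝ᵥ z l ≠ 0 :=
    fun i j l hij hil hjl =>
      triple_ne_zero_of_isotropic hN hdet (hz i j hij) (hz i l hil) (hz j l hjl) (h i) (h j) (h l)
  have h012 := htriple 0 1 2 (by decide) (by decide) (by decide)
  obtain ⟨x, y, t, h3⟩ := exists_combo_three h012 (z 3)
  obtain ⟨x', y', t', h4⟩ := exists_combo_three h012 (z 4)
  have hcoord : ∀ (w : Fin 3 → k) (a b c : k), w = a • z 0 + b • z 1 + c • z 2 →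
      crossProduct (z 1) (z 2) ⬝ᵥ w = a * (crossProduct (z 0) (z 1) ⬝ᵥ z 2) ∧
      crossProduct (z 0) (z 2) ⬝ᵥ w = -b * (crossProduct (z 0) (z 1) ⬝ᵥ z 2) ∧
      crossProduct (z 0) (z 1) ⬝ᵥ w = c * (crossProduct (z 0) (z 1) ⬝ᵥ z 2) := by
    rintro w a b c rfl
    refine ⟨?_, ?_, ?_⟩ <;>
    · simp [cross_apply, dotProduct, Fin.sum_univ_three]
      ring
  have hne : ∀ (i : Fin 5) (a b c : k), i ≠ 0 → i ≠ 1 → i ≠ 2 →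
      z i = a • z 0 + b • z 1 + c • z 2 → a ≠ 0 ∧ b ≠ 0 ∧ c ≠ 0 := by
    intro i a b c h0 h1 h2 hi
    obtain ⟨e1, e2, e3⟩ := hcoord _ a b c hi
    refine ⟨?_, ?_, ?_⟩ <;> rintro rfl
    · exact htriple 1 2 i (by decide) h1.symm h2.symm (by rw [e1, zero_mul])
    · exact htriple 0 2 i (by decide) h0.symm h2.symm (by rw [e2, neg_zero, zero_mul])
    · exact htriple 0 1 i (by decide) h0.symm h1.symm (by rw [e3, zero_mul])
  obtain ⟨hx, hy, ht⟩ := hne 3 x y t (by decide) (by decide) (by decide) h3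
  obtain ⟨hx', hy', ht'⟩ := hne 4 x' y' t' (by decide) (by decide) (by decide) h4
  have hrel : ∀ (L : Matrix (Fin 3) (Fin 3) k), L.IsSymm → (∀ i, bil L (z i) (z i) = 0) →
      (y * t * bil L (z 1) (z 2) + x * t * bil L (z 0) (z 2) + x * y * bil L (z 0) (z 1) = 0) ∧
      (y' * t' * bil L (z 1) (z 2) + x' * t' * bil L (z 0) (z 2) +
        x' * y' * bil L (z 0) (z 1) = 0) := by
    intro L hL hL0
    have e3 := hL0 3
    have e4 := hL0 4
    rw [h3, bil_combo_three hL, hL0 0, hL0 1, hL0 2] at e3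
    rw [h4, bil_combo_three hL, hL0 0, hL0 1, hL0 2] at e4
    simp only [mul_zero, add_zero, zero_add, mul_eq_zero, two_ne_zero, false_or] at e3 e4
    exact ⟨e3, e4⟩
  obtain ⟨r1, r2⟩ := hrel N hN h
  obtain ⟨r1', r2'⟩ := hrel N' hN' h'
  have ha := bil_ne_zero_of_isotropic hN hdet (hz 1 2 (by decide)) (h 1) (h 2)
  have ha' := bil_ne_zero_of_isotropic hN' hdet' (hz 1 2 (by decide)) (h' 1) (h' 2)
  set a := bil N (z 1) (z 2)
  set b := bil N (z 0) (z 2)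
  set c := bil N (z 0) (z 1)
  set a' := bil N' (z 1) (z 2)
  set b' := bil N' (z 0) (z 2)
  set c' := bil N' (z 0) (z 1)
  -- Up to the factor xx', this is the minor of the two conditions in the unknowns b, c. If it
  -- vanished, so would the other two minors of the coordinate vectors, and the fourth and fifth
  -- points would coincide.
  have hminor : t * y' - y * t' ≠ 0 := by
    intro hm1
    have hm2 : x * t' - t * x' = 0 := by
      have : a' * (y * y') * (x * t' - t * x') = 0 := by
        linear_combination -x' * y' * r1' + x * y * r2' + b' * x * x' * hm1
      simpa [ha', hy, hy'] using this
    have hm3 : y * x' - x * y' = 0 := by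
      have : a' * (t * t') * (y * x' - x * y') = 0 := by
        linear_combination x' * t' * r1' - x * t * r2' + c' * x * x' * hm1
      simpa [ha', ht, ht'] using this
    apply hz 3 4 (by decide)
    rw [h3, h4]
    ext i
    fin_cases i <;> simp [cross_apply]
    · linear_combination (-hm3) * (z 0 1 * z 1 2 - z 0 2 * z 1 1) +
        hm2 * (z 0 1 * z 2 2 - z 0 2 * z 2 1) - hm1 * (z 1 1 * z 2 2 - z 1 2 * z 2 1)
    · linear_combination (-hm3) * (z 0 2 * z 1 0 - z 0 0 * z 1 2) +
        hm2 * (z 0 2 * z 2 0 - z 0 0 * z 2 2) - hm1 * (z 1 2 * z 2 0 - z 1 0 * z 2 2)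
    · linear_combination (-hm3) * (z 0 0 * z 1 1 - z 0 1 * z 1 0) +
        hm2 * (z 0 0 * z 2 1 - z 0 1 * z 2 0) - hm1 * (z 1 0 * z 2 1 - z 1 1 * z 2 0)
  have hm : x * x' * (t * y' - y * t') ≠ 0 := mul_ne_zero (mul_ne_zero hx hx') hminor
  -- Eliminating c, and below b, expresses both through a in the same way for the two forms.
  have hb : b = a / a' * b' := by
    rw [div_mul_eq_mul_div, eq_div_iff ha']
    refine mul_left_cancel₀ hm ?_
    linear_combination a' * (x' * y' * r1 - x * y * r2) - a * (x' * y' * r1' - x * y * r2')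
  have hc : c = a / a' * c' := by
    rw [div_mul_eq_mul_div, eq_div_iff ha']
    refine mul_left_cancel₀ hm ?_
    linear_combination -a' * (x' * t' * r1 - x * t * r2) + a * (x' * t' * r1' - x * t * r2')
  refine ⟨a / a', div_ne_zero ha ha', fun w => ?_⟩
  obtain ⟨α, β, γ, rfl⟩ := exists_combo_three h012 w
  rw [bil_combo_three hN, bil_combo_three hN', h 0, h 1, h 2, h' 0, h' 1, h' 2]
  change _ + 2 * (β * γ * a + α * γ * b + α * β * c) =
    _ * (_ + 2 * (β * γ * a' + α * γ * b' + α * β * c'))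
  rw [hb, hc]
  field_simp
  ring

theorem bil_adjugate_eq_of_bil_eq [CharZero k] {N N' : Matrix (Fin 3) (Fin 3) k} (hN : N.IsSymm)
    (hN' : N'.IsSymm) {c : k} (h : ∀ w, bil N w w = c * bil N' w w) (p : Fin 3 → k) :
    bil N.adjugate p p = c ^ 2 * bil N'.adjugate p p := by
  rcases eq_or_ne p 0 with rfl | hp
  · simp [bil]
  obtain ⟨u, v, s, hs, -, -, huv⟩ := exists_cross_eq_smul hp
  have hpol : bil N u v = c * bil N' u v := by
    have h1 := h (u + v)
    rw [bil_add_self hN, bil_add_self hN', h u, h v] at h1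
    exact mul_left_cancel₀ two_ne_zero (by linear_combination h1)
  have e := bil_adjugate_cross hN u v
  have e' := bil_adjugate_cross hN' u v
  rw [huv, bil_smul_left, bil_smul_right] at e e'
  rw [hpol, h u, h v] at e
  refine mul_left_cancel₀ (mul_ne_zero hs hs) ?_
  linear_combination e - c ^ 2 * e'

end TernaryForms

/-! ### Conics, their duals and common tangents -/

section Conics

open Matrix

variable {k : Type*} [Field k]

theorem eval_quadForm_eq_bil (M : Matrix (Fin 3) (Fin 3) k) (x : Fin 3 → k) :
    eval x (quadForm M) = bil M x x := eval_quadForm M x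

theorem eval_pderiv_quadForm {M : Matrix (Fin 3) (Fin 3) k} (hM : M.IsSymm) (x : Fin 3 → k)
    (i : Fin 3) : eval x (pderiv i (quadForm M)) = 2 * M.mulVec x i := by
  have h1 := hM.apply 0 1
  have h2 := hM.apply 0 2
  have h3 := hM.apply 1 2
  fin_cases i <;>
  · simp [quadForm, linForm, Fin.sum_univ_three, pderiv_X, mulVec, dotProduct, h1, h2, h3]
    ring

/-- Splitting x orthogonally as (ℓ(x)/q)p + Y(x) gives F(x) = ℓ(x)²/q + F(Y(x)), so D = -qF(Y). The
coordinates of Y are linear forms vanishing at P. -/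
theorem isDiscriminant_quadForm [CharZero k] {M : Matrix (Fin 3) (Fin 3) k} (hM : M.IsSymm)
    {P : ℙ k (Fin 3 → k)} (hq : bil M P.rep P.rep ≠ 0) :
    IsDiscriminant P (quadForm M) (linForm (M.mulVec P.rep))
      (linForm (M.mulVec P.rep) ^ 2 - C (bil M P.rep P.rep) * quadForm M)
      (bil M P.rep P.rep) where
  linear := linForm_isHomogeneous _
  eval_linear := by rw [eval_linForm, dotProduct_comm]; rfl
  ne_zero := hq
  quadratic := by
    refine IsHomogeneous.sub ?_ ?_
    · simpa using (linForm_isHomogeneous (M.mulVec P.rep)).pow 2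
    · simpa using (isHomogeneous_C (Fin 3) (bil M P.rep P.rep)).mul (quadForm_isHomogeneous M)
  eq := rfl
  mem := by
    set q := bil M P.rep P.rep with hqdef
    set ℓ := linForm (M.mulVec P.rep) with hℓ
    have hℓx : ∀ x, eval x ℓ = bil M x P.rep := fun x => by
      rw [hℓ, eval_linForm, dotProduct_comm]; rfl
    let Y : Fin 3 → MvPolynomial (Fin 3) k := fun i => X i - C (P.rep i / q) * ℓ
    have hY : ∀ i, Y i ∈ pencilRing P := fun i => by
      refine Algebra.subset_adjoin ⟨(isHomogeneous_X k i).sub ?_, ?_⟩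
      · simpa using (isHomogeneous_C (Fin 3) (P.rep i / q)).mul (linForm_isHomogeneous _)
      · rw [map_sub, map_mul, hℓx, eval_X, eval_C, ← hqdef, div_mul_cancel₀ _ hq, sub_self]
    have hD : ℓ ^ 2 - C q * quadForm M = C (-q) * aeval Y (quadForm M) := by
      refine MvPolynomial.funext fun x => ?_
      have hYx : eval x (aeval Y (quadForm M)) =
          eval (x + (-(bil M x P.rep / q)) • P.rep) (quadForm M) := by
        rw [← coe_aeval_eq_eval, ← coe_aeval_eq_eval]
        change aeval x (aeval Y (quadForm M)) = _
        rw [comp_aeval_apply]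
        change _ = aeval _ (quadForm M)
        congr 2
        funext i
        change eval x (Y i) = _
        simp only [Y, map_sub, map_mul, eval_X, eval_C, hℓx, Pi.add_apply, Pi.smul_apply,
          smul_eq_mul]
        ring
      rw [map_mul, hYx, map_sub, map_mul, map_pow, hℓx, eval_C, eval_C, eval_quadForm_eq_bil,
        eval_quadForm_eq_bil, bil_add_self hM, bil_smul_right, bil_smul_right, bil_smul_left,
        ← hqdef]
      field_simp
      ring
    rw [hD]
    refine mul_mem (Subalgebra.algebraMap_mem _ _) ?_
    induction quadForm M using MvPolynomial.induction_on with
    | C a => rw [aeval_C]; exact Subalgebra.algebraMap_mem _ _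
    | add G H hG hH => rw [map_add]; exact add_mem hG hH
    | mul_X G i hG => rw [map_mul, aeval_X]; exact mul_mem hG (hY i)

theorem eval_discriminant_quadForm {M : Matrix (Fin 3) (Fin 3) k} (hM : M.IsSymm)
    (p x : Fin 3 → k) :
    eval x (linForm (M.mulVec p) ^ 2 - C (bil M p p) * quadForm M) =
      -bil M.adjugate (crossProduct p x) (crossProduct p x) := by
  have h : eval x (linForm (M.mulVec p)) = bil M p x := by
    rw [eval_linForm, dotProduct_comm, bil_comm hM]; rfl
  rw [bil_adjugate_cross hM, map_sub, map_mul, map_pow, h, eval_C, eval_quadForm_eq_bil]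
  ring

/-- As x varies, p × x runs through all of p^⊥. -/
theorem discriminant_quadForm_eq_C_mul_iff [CharZero k] {M M' : Matrix (Fin 3) (Fin 3) k}
    (hM : M.IsSymm) (hM' : M'.IsSymm) {p : Fin 3 → k} (hp : p ≠ 0) (c : k) :
    linForm (M.mulVec p) ^ 2 - C (bil M p p) * quadForm M =
        C c * (linForm (M'.mulVec p) ^ 2 - C (bil M' p p) * quadForm M') ↔
      ∀ w, p ⬝ᵥ w = 0 → bil M.adjugate w w = c * bil M'.adjugate w w := by
  constructor
  · intro h w hw
    obtain ⟨x, rfl⟩ := exists_eq_cross hp hw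
    have h1 := congrArg (eval x) h
    rw [map_mul, eval_C, eval_discriminant_quadForm hM, eval_discriminant_quadForm hM'] at h1
    linear_combination -h1
  · intro h
    refine MvPolynomial.funext fun x => ?_
    rw [map_mul, eval_C, eval_discriminant_quadForm hM, eval_discriminant_quadForm hM',
      h _ (dot_self_cross p x)]
    ring

theorem IrreduciblePlaneCurve.exists_matrix [CharZero k] (C : IrreduciblePlaneCurve k)
    (hdeg : C.degree = 2) (hns : C.Nonsingular) :
    ∃ M : Matrix (Fin 3) (Fin 3) k, M.IsSymm ∧ C.form = quadForm M ∧ M.det ≠ 0 := by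
  have hhom := C.isHomogeneous
  rw [show C.form.totalDegree = 2 from hdeg] at hhom
  obtain ⟨M, hM, hF⟩ := exists_eq_quadForm hhom
  -- A kernel vector of `M` would be a singular point of the curve, because the gradient is 2Mx.
  refine ⟨M, hM, hF, fun hdet => ?_⟩
  obtain ⟨v, hv, hMv⟩ := Matrix.exists_mulVec_eq_zero_iff.2 hdet
  obtain ⟨a, ha⟩ := Projectivization.exists_smul_eq_mk_rep k v hv
  have hrep : M.mulVec (Projectivization.mk k v hv).rep = 0 := by
    rw [← ha, Units.smul_def, mulVec_smul, hMv, smul_zero]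
  obtain ⟨i, hi⟩ := hns (Projectivization.mk k v hv) (by
    change eval _ _ = 0
    rw [hF, eval_quadForm, hrep, dotProduct_zero])
  exact hi (by rw [hF, eval_pderiv_quadForm hM, hrep, Pi.zero_apply, mul_zero])

theorem mem_outerSGPoints_iff [IsAlgClosed k] [CharZero k] {ι : Type*}
    {C : ι → IrreduciblePlaneCurve k} (hdeg : ∀ i, (C i).degree = 2)
    {M : ι → Matrix (Fin 3) (Fin 3) k} (hM : ∀ i, (M i).IsSymm)
    (hF : ∀ i, (C i).form = quadForm (M i)) (P : ℙ k (Fin 3 → k)) :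
    P ∈ outerSGPoints C ↔ (∀ i, bil (M i) P.rep P.rep ≠ 0) ∧ ∀ i j, ∃ c : k, c ≠ 0 ∧
      ∀ w, P.rep ⬝ᵥ w = 0 → bil (M i).adjugate w w = c * bil (M j).adjugate w w := by
  have hpts : (∀ i, P ∉ (C i).points) ↔ ∀ i, bil (M i) P.rep P.rep ≠ 0 := by
    refine forall_congr' fun i => not_congr ?_
    rw [← eval_quadForm_eq_bil, ← hF]
    rfl
  change IsSGPoint C P ∧ _ ↔ _
  rw [hpts, and_comm]
  refine and_congr_right fun hq => ?_
  rw [isSGPoint_iff hdeg fun i => by rw [hF]; exact isDiscriminant_quadForm (hM i) (hq i)]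
  refine forall₂_congr fun i j => exists_congr fun c => and_congr_right fun _ => ?_
  exact discriminant_quadForm_eq_C_mul_iff (hM i) (hM j) P.rep_nonzero c

theorem cross_rep_ne_zero {u v : ℙ k (Fin 3 → k)} (h : u ≠ v) :
    crossProduct u.rep v.rep ≠ 0 := fun h0 => h (by
  rw [← u.mk_rep, ← v.mk_rep]
  exact (Projectivization.mk_eq_mk_iff_crossProduct_eq_zero u.rep_nonzero v.rep_nonzero).2 h0)

/-- The common zeros in the projective plane of the quadratic forms with matrices `N i`. -/
def commonZeros {ι : Type*} (N : ι → Matrix (Fin 3) (Fin 3) k) : Set (ℙ k (Fin 3 → k)) :=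
  {v | ∀ i, bil (N i) v.rep v.rep = 0}

theorem bil_mk_rep_eq_zero {N : Matrix (Fin 3) (Fin 3) k} {u : Fin 3 → k} (hu : u ≠ 0)
    (h : bil N u u = 0) :
    bil N (Projectivization.mk k u hu).rep (Projectivization.mk k u hu).rep = 0 := by
  obtain ⟨a, ha⟩ := Projectivization.exists_smul_eq_mk_rep k u hu
  rw [← ha, Units.smul_def, bil_smul_left, bil_smul_right, h, mul_zero, mul_zero]

theorem dotProduct_mk_rep_eq_zero {p u : Fin 3 → k} (hu : u ≠ 0) (h : p ⬝ᵥ u = 0) :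
    p ⬝ᵥ (Projectivization.mk k u hu).rep = 0 := by
  obtain ⟨a, ha⟩ := Projectivization.exists_smul_eq_mk_rep k u hu
  rw [← ha, Units.smul_def, dotProduct_smul, h, smul_zero]

theorem encard_commonZeros_le_four [CharZero k] {N : Fin 2 → Matrix (Fin 3) (Fin 3) k}
    (hN : ∀ i, (N i).IsSymm) (hdet : ∀ i, (N i).det ≠ 0)
    (hne : ∀ c : k, c ≠ 0 → ∃ w, bil (N 0) w w ≠ c * bil (N 1) w w) :
    (commonZeros N).encard ≤ 4 := by
  by_contra! hlt
  have h5 : (5 : ℕ∞) ≤ (commonZeros N).encard := by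
    have := Order.add_one_le_of_lt hlt
    simpa [show (4 : ℕ∞) + 1 = 5 by norm_num] using this
  obtain ⟨t, ht, ht5⟩ := Set.exists_subset_encard_eq h5
  have hfin : t.Finite := Set.finite_of_encard_eq_coe (k := 5) ht5
  have hcard : hfin.toFinset.card = 5 := by
    rw [hfin.encard_eq_coe_toFinset_card] at ht5
    exact_mod_cast ht5
  let e := (hfin.toFinset.equivFinOfCardEq hcard).symm
  have hz : ∀ i, (e i : ℙ k (Fin 3 → k)) ∈ commonZeros N := fun i =>
    ht (hfin.mem_toFinset.1 (e i).2)
  obtain ⟨c, hc, h⟩ := exists_bil_eq_mul_of_five_isotropic (hN 0) (hdet 0) (hN 1) (hdet 1)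
    (z := fun i => (e i : ℙ k (Fin 3 → k)).rep)
    (fun i j hij => cross_rep_ne_zero fun h => hij (e.injective (Subtype.ext h)))
    (fun i => hz i 0) (fun i => hz i 1)
  obtain ⟨w, hw⟩ := hne c hc
  exact hw (h w)

/-- Proportional forms on p^⊥ have the same zeros there, and one of them has exactly two. -/
theorem exists_pair_of_mem_outerSGPoints [IsAlgClosed k] [CharZero k] {ι : Type*} [Nonempty ι]
    {N : ι → Matrix (Fin 3) (Fin 3) k} (hN : ∀ i, (N i).IsSymm) (hdet : ∀ i, (N i).det ≠ 0)
    {p : Fin 3 → k} (hp : ∀ i, bil (N i).adjugate p p ≠ 0)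
    (h : ∀ i j, ∃ c : k, c ≠ 0 ∧ ∀ w, p ⬝ᵥ w = 0 → bil (N i) w w = c * bil (N j) w w) :
    ∃ u v : ℙ k (Fin 3 → k), u ≠ v ∧ {x ∈ commonZeros N | p ⬝ᵥ x.rep = 0} = {u, v} := by
  obtain ⟨i₀⟩ := ‹Nonempty ι›
  have hp0 : p ≠ 0 := by rintro rfl; exact hp i₀ (by simp [bil])
  obtain ⟨u, v, hu, hv, huv, hu0, hv0⟩ := exists_isotropic_pair (hN i₀) (hp i₀)
  have hune : u ≠ 0 := by rintro rfl; simp at huv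
  have hvne : v ≠ 0 := by rintro rfl; simp at huv
  have hall : ∀ w, p ⬝ᵥ w = 0 → bil (N i₀) w w = 0 → ∀ i, bil (N i) w w = 0 := by
    intro w hw h0 i
    obtain ⟨c, -, hc⟩ := h i i₀
    rw [hc w hw, h0, mul_zero]
  refine ⟨.mk k u hune, .mk k v hvne, fun heq => huv
    ((Projectivization.mk_eq_mk_iff_crossProduct_eq_zero hune hvne).1 heq), ?_⟩
  refine Set.Subset.antisymm ?_ ?_
  · rintro x ⟨hxZ, hx⟩
    obtain ⟨c, hc, hcp⟩ := exists_cross_eq_smul_of_orthogonal hp0 huv hu hv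
    obtain ⟨a, b, hab⟩ := exists_combo_two (w := x.rep) huv
      (by rw [hcp, smul_dotProduct, hx, smul_zero])
    have hx0 := hxZ i₀
    rw [hab] at hx0
    rcases eq_zero_or_eq_zero_of_isotropic (hN i₀) (hdet i₀) huv hu0 hv0 hx0 with rfl | rfl
    · right
      rw [Set.mem_singleton_iff, ← x.mk_rep, Projectivization.mk_eq_mk_iff']
      exact ⟨b, by rw [hab, zero_smul, zero_add]⟩
    · left
      rw [← x.mk_rep, Projectivization.mk_eq_mk_iff']
      exact ⟨a, by rw [hab, zero_smul, add_zero]⟩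
  · rintro x (rfl | rfl)
    · exact ⟨fun i => bil_mk_rep_eq_zero hune (hall u hu hu0 i), dotProduct_mk_rep_eq_zero hune hu⟩
    · exact ⟨fun i => bil_mk_rep_eq_zero hvne (hall v hv hv0 i), dotProduct_mk_rep_eq_zero hvne hv⟩

end Conics

/-! ### Counting pairs of common tangents -/

section Counting

open Matrix

variable {k : Type*} [Field k]

theorem bil_adjugate_adjugate (M : Matrix (Fin 3) (Fin 3) k) (p : Fin 3 → k) :
    bil M.adjugate.adjugate p p = M.det * bil M p p := by
  rw [adjugate_adjugate M (by simp)]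
  simp [bil, smul_mulVec]

/-- Outer simultaneous Galois points correspond to pairs of common tangent lines, that is, of
common points of the dual conics. -/
theorem encard_outerSGPoints_eq_choose [IsAlgClosed k] [CharZero k] {ι : Type*} [Nonempty ι]
    {C : ι → IrreduciblePlaneCurve k} (hdeg : ∀ i, (C i).degree = 2)
    {M : ι → Matrix (Fin 3) (Fin 3) k} (hM : ∀ i, (M i).IsSymm)
    (hF : ∀ i, (C i).form = quadForm (M i)) (hdet : ∀ i, (M i).det ≠ 0)
    (hfin : (commonZeros fun i => (M i).adjugate).Finite) :
    (outerSGPoints C).encard = (hfin.toFinset.card.choose 2 : ℕ) := by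
  classical
  set N := fun i => (M i).adjugate with hNdef
  have hN : ∀ i, (N i).IsSymm := fun i => by
    rw [IsSymm, hNdef, adjugate_transpose, (hM i).eq]
  have hNdet : ∀ i, (N i).det ≠ 0 := fun i => by
    rw [hNdef, det_adjugate]
    exact pow_ne_zero _ (hdet i)
  have hadj : ∀ i p, bil (N i).adjugate p p ≠ 0 ↔ bil (M i) p p ≠ 0 := fun i p => by
    rw [hNdef, bil_adjugate_adjugate]
    simp [hdet i]
  -- The common tangents through P; on outer simultaneous Galois points this is the bijection onto
  -- pairs.
  let g : ℙ k (Fin 3 → k) → Finset (ℙ k (Fin 3 → k)) := fun P =>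
    hfin.toFinset.filter fun x => P.rep ⬝ᵥ x.rep = 0
  have hpair : ∀ P ∈ outerSGPoints C, ∃ u v, u ≠ v ∧ g P = {u, v} := by
    intro P hP
    obtain ⟨hq, hc⟩ := (mem_outerSGPoints_iff hdeg hM hF P).1 hP
    obtain ⟨u, v, huv, hset⟩ := exists_pair_of_mem_outerSGPoints hN hNdet
      (fun i => (hadj i _).2 (hq i)) hc
    refine ⟨u, v, huv, ?_⟩
    ext x
    have := Set.ext_iff.1 hset x
    simpa [g] using this
  have hcard : ∀ P ∈ outerSGPoints C, (g P).card = 2 := by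
    intro P hP
    obtain ⟨u, v, huv, h⟩ := hpair P hP
    rw [h, Finset.card_pair huv]
  have hmem : ∀ {P x}, x ∈ g P ↔ x ∈ commonZeros N ∧ P.rep ⬝ᵥ x.rep = 0 := by
    intro P x
    simp [g]
  -- P is recovered as u × v, the intersection of its two tangents.
  have hinj : Set.InjOn g (outerSGPoints C) := by
    intro P hP P' hP' heq
    obtain ⟨u, v, huv, h⟩ := hpair P hP
    have hu : u ∈ g P := by simp [h]
    have hv : v ∈ g P := by simp [h]
    obtain ⟨c, hc, hcP⟩ := exists_cross_eq_smul_of_orthogonal P.rep_nonzero (cross_rep_ne_zero huv)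
      (hmem.1 hu).2 (hmem.1 hv).2
    rw [heq] at hu hv
    obtain ⟨c', hc', hcP'⟩ := exists_cross_eq_smul_of_orthogonal P'.rep_nonzero
      (cross_rep_ne_zero huv) (hmem.1 hu).2 (hmem.1 hv).2
    rw [← P.mk_rep, ← P'.mk_rep, Projectivization.mk_eq_mk_iff']
    refine ⟨c⁻¹ * c', ?_⟩
    rw [mul_smul, ← hcP', hcP, smul_smul, inv_mul_cancel₀ hc, one_smul]
  have himage : g '' outerSGPoints C = ↑(hfin.toFinset.powersetCard 2) := by
    refine Set.Subset.antisymm ?_ ?_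
    · rintro _ ⟨P, hP, rfl⟩
      exact Finset.mem_coe.2 (Finset.mem_powersetCard.2 ⟨Finset.filter_subset _ _, hcard P hP⟩)
    · intro s hs
      obtain ⟨hsub, hs2⟩ := Finset.mem_powersetCard.1 (Finset.mem_coe.1 hs)
      obtain ⟨u, v, huv, rfl⟩ := Finset.card_eq_two.1 hs2
      have hu : u ∈ commonZeros N := hfin.mem_toFinset.1 (hsub (by simp))
      have hv : v ∈ commonZeros N := hfin.mem_toFinset.1 (hsub (by simp))
      have hcross := cross_rep_ne_zero huv
      set P := Projectivization.mk k _ hcross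
      obtain ⟨a, ha⟩ := Projectivization.exists_smul_eq_mk_rep k _ hcross
      have hPu : P.rep ⬝ᵥ u.rep = 0 := by
        rw [← ha, Units.smul_def, smul_dotProduct, dotProduct_comm, dot_self_cross, smul_zero]
      have hPv : P.rep ⬝ᵥ v.rep = 0 := by
        rw [← ha, Units.smul_def, smul_dotProduct, dotProduct_comm, dot_cross_self, smul_zero]
      have hP : P ∈ outerSGPoints C := by
        rw [mem_outerSGPoints_iff hdeg hM hF]
        refine ⟨fun i => ?_, fun i j => ?_⟩
        -- The dual of `N i` at u × v is -N(u, v)², nonzero for two distinct isotropic points, so P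
        -- is off the curve.
        · rw [← hadj, ← ha, Units.smul_def, bil_smul_left, bil_smul_right,
            bil_adjugate_cross (hN i), hu i, hv i, zero_mul, zero_sub]
          exact mul_ne_zero a.ne_zero (mul_ne_zero a.ne_zero (neg_ne_zero.2 (pow_ne_zero 2
            (bil_ne_zero_of_isotropic (hN i) (hNdet i) hcross (hu i) (hv i)))))
        · obtain ⟨c, hc, h⟩ := exists_bil_eq_mul_of_isotropic_pair (hN i) (hNdet i) (hN j)
            (hNdet j) hcross (hu i) (hv i) (hu j) (hv j)
          refine ⟨c, hc, fun w hw => h w ?_⟩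
          rw [← ha, Units.smul_def, smul_dotProduct, smul_eq_mul] at hw
          exact (mul_eq_zero.1 hw).resolve_left a.ne_zero
      refine ⟨P, hP, (Finset.eq_of_subset_of_card_le ?_ ?_).symm⟩
      · intro x hx
        rcases Finset.mem_insert.1 hx with rfl | hx
        · exact hmem.2 ⟨hu, hPu⟩
        · rw [Finset.mem_singleton.1 hx]
          exact hmem.2 ⟨hv, hPv⟩
      · rw [hcard P hP, Finset.card_pair huv]
  rw [← hinj.encard_image, himage, Set.encard_coe_eq_coe_finsetCard, Finset.card_powersetCard]

end Counting

end SGPoints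

end

theorem theorem3p1 {k : Type*} [Field k] [IsAlgClosed k] [CharZero k]
    (C : Fin 2 → SGPoints.IrreduciblePlaneCurve k)
    (hdeg : ∀ i, (C i).degree = 2)
    (hns : ∀ i, (C i).Nonsingular)
    (hne : (C 0).points ≠ (C 1).points) :
    (SGPoints.outerSGPoints C).encard ∈ ({0, 1, 3, 6} : Set ℕ∞) := by
  choose M hM hF hdet using fun i => (C i).exists_matrix (hdeg i) (hns i)
  have hN : ∀ i, (M i).adjugate.IsSymm := fun i => by
    rw [Matrix.IsSymm, Matrix.adjugate_transpose, (hM i).eq]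
  have hNdet : ∀ i, (M i).adjugate.det ≠ 0 := fun i => by
    rw [Matrix.det_adjugate]
    exact pow_ne_zero _ (hdet i)
  have hle : (SGPoints.commonZeros fun i => (M i).adjugate).encard ≤ 4 := by
    refine SGPoints.encard_commonZeros_le_four hN hNdet fun c hc => ?_
    -- Proportional dual forms have proportional adjugates, which are the original forms up to
    -- determinants; the two curves would have the same points.
    by_contra! h
    refine hne (Set.ext fun P => ?_)
    change eval P.rep (C 0).form = 0 ↔ eval P.rep (C 1).form = 0
    have h1 := SGPoints.bil_adjugate_eq_of_bil_eq (hN 0) (hN 1) h P.rep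
    rw [SGPoints.bil_adjugate_adjugate, SGPoints.bil_adjugate_adjugate] at h1
    rw [hF, hF, SGPoints.eval_quadForm_eq_bil, SGPoints.eval_quadForm_eq_bil,
      ← mul_eq_zero_iff_left (hdet 0), h1]
    simp [hc, hdet 1]
  have hfin := Set.finite_of_encard_le_coe (k := 4) hle
  rw [SGPoints.encard_outerSGPoints_eq_choose hdeg hM hF hdet hfin]
  have hcard : hfin.toFinset.card ≤ 4 := by
    rw [hfin.encard_eq_coe_toFinset_card] at hle
    exact_mod_cast hle
  generalize hfin.toFinset.card = n at hcard
  interval_cases n <;> simp [Nat.choose]
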